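/- Let $R$ be a commutative noetherian ring, $J\subset R$ an ideal, and $\hat R=\varprojlim_n R/J^n$ the $J$-adic completion. Let $\operatorname{mod}(R)$ be the category of finitely generated $R$-modules and $\operatorname{Pro}(\operatorname{mod}(R))$ its category of pro-objects: the objects are the small cofiltered inverse systems $(M_\alpha)_\alpha$ in $\operatorname{mod}(R)$, and $\operatorname{Hom}((M_\alpha)_\alpha,(N_\beta)_\beta)=\varprojlim_\beta\varinjlim_\alpha\operatorname{Hom}_R(M_\alpha,N_\beta)$. The completion $\operatorname{mod}(R)\hat{\ }$ of $\operatorname{mod}(R)$ with respect to $J$ is the full subcategory of $\operatorname{Pro}(\operatorname{mod}(R))$ of the pro-objects $M$ such that $M/MJ^n\in\operatorname{mod}(R)$ for all $n$ and such that the canonical map $M\to\varprojlim_n M/MJ^n$ (limit in $\operatorname{Pro}(\operatorname{mod}(R))$) is an isomorphism. Let $P$ be the pro-object $\varprojlim_n R/J^n$, that is, the inverse system $(R/J^n)_n$. Then $P$ lies in $\operatorname{mod}(R)\hat{\ }$ and is a projective generator of it: $P$ is projective in $\operatorname{mod}(R)\hat{\ }$, it is a separator, and every object $M$ of $\operatorname{mod}(R)\hat{\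 }$ admits an epimorphism $P^{t}\to M$ from a finite direct sum of copies of $P$. There is an isomorphism of $R$-algebras $\hat R\cong\operatorname{End}(P)$, and an $R$-linear equivalence of categories $$\operatorname{mod}(R)\hat{\ }\;\simeq\;\operatorname{mod}(\hat R)$$ with the category of finitely generated $\hat R$-modules, given by $M\mapsto\operatorname{Hom}(P,M)$, where $\hat R\cong\operatorname{End}(P)$ acts by composition. -/

import Mathlib

open CategoryTheory CategoryTheory.Limits Opposite

universe u w

noncomputable section

/-- Pro-objects over an `R`-linear category `C`: small cofiltered diagrams in `C`, thought of as
formal inverse limits. (The ring `R` only serves to fix the linear structure on morphisms.) -/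
structure ProCat (R : Type u) (C : Type w) [Category.{u} C] where
  /-- the index category -/
  I : Type u
  [smallCategory : SmallCategory I]
  [isCofiltered : IsCofiltered I]
  /-- the inverse system -/
  diag : I ⥤ C

namespace ProCat

attribute [instance] ProCat.smallCategory ProCat.isCofiltered

variable {R : Type u} [CommRing R] {C : Type w} [Category.{u} C] [Preadditive C] [Linear R C]

/-- The functor `c ↦ colim_α Hom_C(X_α, c)` attached to the pro-object `X = (X_α)_α`. -/
def hom (X : ProCat R C) : C ⥤ ModuleCat.{u} R :=
  colimit (X.diag.op ⋙ linearCoyoneda R C)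

/-- Morphisms of pro-objects. A morphism `X ⟶ Y` is a natural map
`colim_β Hom_C(Y_β, -) ⟶ colim_α Hom_C(X_α, -)`; by the Yoneda lemma such maps are the elements
of `lim_β colim_α Hom_C(X_α, Y_β)`, see `ProCat.homEquiv`. -/
instance : Category.{max u w} (ProCat R C) where
  Hom X Y := Y.hom ⟶ X.hom
  id X := 𝟙 X.hom
  comp f g := CategoryStruct.comp (obj := C ⥤ ModuleCat.{u} R) g f

instance : Preadditive (ProCat R C) where
  homGroup X Y := inferInstanceAs (AddCommGroup (Y.hom ⟶ X.hom))
  add_comp _ _ _ f f' g := Preadditive.comp_add (C := C ⥤ ModuleCat.{u} R) _ _ _ g f f'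
  comp_add _ _ _ f g g' := Preadditive.add_comp (C := C ⥤ ModuleCat.{u} R) _ _ _ g g' f

instance : Linear R (ProCat R C) where
  homModule X Y := inferInstanceAs (Module R (Y.hom ⟶ X.hom))
  smul_comp _ _ _ r f g := Linear.comp_smul (C := C ⥤ ModuleCat.{u} R) _ _ _ g r f
  comp_smul _ _ _ f r g := Linear.smul_comp (C := C ⥤ ModuleCat.{u} R) _ _ _ r g f

/-- The canonical map `Hom_C(X_α, -) ⟶ colim_α Hom_C(X_α, -)`. -/
def ι (X : ProCat R C) (α : X.I) : (linearCoyoneda R C).obj (op (X.diag.obj α)) ⟶ X.hom :=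
  colimit.ι (X.diag.op ⋙ linearCoyoneda R C) (op α)

theorem hom_obj_ext (X : ProCat R C) {c : C} {M : ModuleCat.{u} R} {f g : X.hom.obj c ⟶ M}
    (h : ∀ α, (X.ι α).app c ≫ f = (X.ι α).app c ≫ g) : f = g :=
  colimit_obj_ext fun j ↦ h j.unop

theorem hom_map_add (X : ProCat R C) {c d : C} (f g : c ⟶ d) :
    X.hom.map (f + g) = X.hom.map f + X.hom.map g := by
  apply X.hom_obj_ext
  intro α
  rw [Preadditive.comp_add, ← (X.ι α).naturality, ← (X.ι α).naturality, ← (X.ι α).naturality,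
    ← Preadditive.add_comp]
  congr 1
  ext x
  exact Preadditive.comp_add _ _ _ x f g

theorem hom_map_smul (X : ProCat R C) {c d : C} (r : R) (f : c ⟶ d) :
    X.hom.map (r • f) = r • X.hom.map f := by
  apply X.hom_obj_ext
  intro α
  rw [Linear.comp_smul, ← (X.ι α).naturality, ← (X.ι α).naturality, ← Linear.smul_comp]
  congr 1
  ext x
  exact Linear.comp_smul _ _ _ x r f

/-- The Yoneda lemma: an element of `colim_α Hom_C(X_α, c)` as a map
`Hom_C(c, -) ⟶ colim_α Hom_C(X_α, -)`. -/
def ofElem (X : ProCat R C) {c : C} (x : X.hom.obj c) :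
    (linearCoyoneda R C).obj (op c) ⟶ X.hom where
  app d := ModuleCat.ofHom
    { toFun := fun g : c ⟶ d ↦ (X.hom.map g).hom x
      map_add' := fun g g' ↦ by rw [hom_map_add]; rfl
      map_smul' := fun r g ↦ by rw [hom_map_smul]; rfl }
  naturality d d' g := by
    ext h
    exact congr($(X.hom.map_comp (show c ⟶ d from h) g).hom x)

/-- The element of `lim_β colim_α Hom_C(X_α, Y_β)` given by a morphism `X ⟶ Y`. -/
def elem {X Y : ProCat R C} (f : X ⟶ Y) (β : Y.I) : X.hom.obj (Y.diag.obj β) :=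
  ((Y.ι β ≫ (show Y.hom ⟶ X.hom from f)).app (Y.diag.obj β)).hom (𝟙 (Y.diag.obj β))

theorem ι_map {X : ProCat R C} {α α' : X.I} (f : α ⟶ α') :
    (linearCoyoneda R C).map (X.diag.map f).op ≫ X.ι α = X.ι α' :=
  colimit.w (X.diag.op ⋙ linearCoyoneda R C) f.op

theorem app_eq {X : ProCat R C} {c d : C} (φ : (linearCoyoneda R C).obj (op c) ⟶ X.hom)
    (g : c ⟶ d) : (φ.app d).hom g = (X.hom.map g).hom ((φ.app c).hom (𝟙 c)) := by
  have h := congr($(φ.naturality g).hom (𝟙 c))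
  have h' : (φ.app d).hom (𝟙 c ≫ g) = (X.hom.map g).hom ((φ.app c).hom (𝟙 c)) := h
  rwa [Category.id_comp] at h'

theorem ofElem_id (X : ProCat R C) {c : C} (x : X.hom.obj c) :
    ((X.ofElem x).app c).hom (𝟙 c) = x :=
  congr($(X.hom.map_id c).hom x)

theorem coyoneda_ext {X : ProCat R C} {c : C} {φ ψ : (linearCoyoneda R C).obj (op c) ⟶ X.hom}
    (h : (φ.app c).hom (𝟙 c) = (ψ.app c).hom (𝟙 c)) : φ = ψ := by
  ext d g
  exact (app_eq φ g).trans ((congrArg _ h).trans (app_eq ψ g).symm)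

/-- The formula `Hom(X, Y) = lim_β colim_α Hom_C(X_α, Y_β)`. -/
def homEquiv (X Y : ProCat R C) :
    (X ⟶ Y) ≃ {s : ∀ β, X.hom.obj (Y.diag.obj β) //
      ∀ ⦃β β' : Y.I⦄ (f : β ⟶ β'), (X.hom.map (Y.diag.map f)).hom (s β) = s β'} where
  toFun f := ⟨elem f, fun β β' g ↦ by
    unfold elem
    rw [← app_eq, ← ι_map g]
    change _ = ((Y.ι β ≫ (show Y.hom ⟶ X.hom from f)).app (Y.diag.obj β')).hom
      (Y.diag.map g ≫ 𝟙 _)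
    rw [Category.comp_id]⟩
  invFun s := colimit.desc (Y.diag.op ⋙ linearCoyoneda R C)
    { pt := X.hom
      ι :=
        { app := fun β ↦ X.ofElem (s.1 β.unop)
          naturality := fun β β' g ↦ by
            change _ = X.ofElem (s.1 β.unop) ≫ 𝟙 _
            rw [Category.comp_id]
            refine coyoneda_ext ?_
            rw [ofElem_id, ← s.2 g.unop]
            change (X.hom.map (Y.diag.map g.unop ≫ 𝟙 _)).hom _ = _
            rw [Category.comp_id] } }
  left_inv f := by
    apply colimit.hom_ext
    intro β
    rw [colimit.ι_desc]
    exact coyoneda_ext (ofElem_id _ _)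
  right_inv s := by
    ext β
    refine Eq.trans (congrArg (fun φ : (linearCoyoneda R C).obj (op (Y.diag.obj β)) ⟶ X.hom ↦
      (φ.app (Y.diag.obj β)).hom (𝟙 (Y.diag.obj β))) ?_) (ofElem_id X (s.1 β))
    exact colimit.ι_desc (F := Y.diag.op ⋙ linearCoyoneda R C) _ (op β)

variable (R) in
/-- The functor sending a cofiltered diagram to its formal inverse limit. -/
def lim (I : Type u) [SmallCategory I] [IsCofiltered I] : (I ⥤ C) ⥤ ProCat R C where
  obj F := { I := I, diag := F }
  map {F G} φ :=
    (colimMap (Functor.whiskerRight (NatTrans.op φ) (linearCoyoneda R C)) :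
      colimit (G.op ⋙ linearCoyoneda R C) ⟶ colimit (F.op ⋙ linearCoyoneda R C))
  map_id F := by
    apply colimit.hom_ext
    intro j
    rw [ι_colimMap]
    change _ = colimit.ι (F.op ⋙ linearCoyoneda R C) j ≫ 𝟙 _
    rw [Category.comp_id]
    convert Category.id_comp (obj := C ⥤ ModuleCat.{u} R) _
    exact (linearCoyoneda R C).map_id _
  map_comp {F G H} f g := by
    apply colimit.hom_ext
    intro j
    rw [ι_colimMap]
    change _ = colimit.ι (H.op ⋙ linearCoyoneda R C) j ≫ (colimMap _ ≫ colimMap _)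
    rw [ι_colimMap_assoc, ι_colimMap, ← Category.assoc]
    congr 1
    exact (linearCoyoneda R C).map_comp _ _

variable (R C) in
/-- The embedding of `C` into its pro-objects, as constant one-object systems. -/
def const : C ⥤ ProCat R C :=
  Functor.const (Discrete PUnit.{u + 1}) ⋙ lim R (Discrete PUnit.{u + 1})

end ProCat

section Completion

variable {R : Type u} [CommRing R]

/-- `π : M ⟶ Q` exhibits `Q` as the quotient `M / MI = M ⊗_R R/I` in an `R`-linear category:
it is the universal morphism out of `M` that is annihilated by the ideal `I`. (It is the cokernel
of `(a₁, …, a_k) : M^k ⟶ M` if `a₁, …, a_k` generate `I`.) -/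
def IsQuotientByIdeal {D : Type*} [Category* D] [Preadditive D] [Linear R D] (I : Ideal R)
    {M Q : D} (π : M ⟶ Q) : Prop :=
  (∀ a ∈ I, a • π = 0) ∧
    ∀ ⦃T : D⦄ (g : M ⟶ T), (∀ a ∈ I, a • g = 0) → ∃! h : Q ⟶ T, π ≫ h = g

variable (J : Ideal R) (C : Type w) [Category.{u} C] [Preadditive C] [Linear R C]

/-- The pro-objects `M` over `C` such that `M / MJⁿ` lies in `C` for all `n` (it is represented by
an object `D n` of `C`, with projection `π n`), and such that the canonical map
`M ⟶ lim_n M / MJⁿ` is an isomorphism (the cone of the projections is a limit cone). The transition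
maps of `D` are the canonical ones, as the maps `π n` are epimorphisms compatible with them. -/
def IsAdicPro : ObjectProperty (ProCat R C) := fun M ↦
  ∃ (D : ℕᵒᵖ ⥤ C) (π : (Functor.const ℕᵒᵖ).obj M ⟶ D ⋙ ProCat.const R C),
    (∀ n : ℕ, IsQuotientByIdeal (J ^ n) (π.app (op n))) ∧ Nonempty (IsLimit (Cone.mk M π))

/-- The completion of the `R`-linear category `C` with respect to the ideal `J`. -/
abbrev AdicCompletionCat : Type (max (u + 1) w) := (IsAdicPro J C).FullSubcategory

/-- The inverse system `… ⟶ R/J² ⟶ R/J ⟶ R/J⁰` of finitely generated `R`-modules. -/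
def adicSystem : (ULift.{u} ℕ)ᵒᵖ ⥤ FGModuleCat.{u} R where
  obj n := FGModuleCat.of R (R ⧸ J ^ n.unop.down)
  map {m n} f := FGModuleCat.ofHom (Ideal.Quotient.factorₐ R
    (Ideal.pow_le_pow_right (I := J) (show n.unop ≤ m.unop from leOfHom f.unop))).toLinearMap
  map_id n := by
    apply FGModuleCat.hom_ext
    apply LinearMap.ext
    intro x
    obtain ⟨x, rfl⟩ := Ideal.Quotient.mk_surjective x
    rfl
  map_comp f g := by
    apply FGModuleCat.hom_ext
    apply LinearMap.ext
    intro x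
    obtain ⟨x, rfl⟩ := Ideal.Quotient.mk_surjective x
    rfl

/-- The pro-object `lim_n R/Jⁿ` over the category of finitely generated `R`-modules. -/
def adicPro : ProCat R (FGModuleCat.{u} R) := (ProCat.lim R _).obj (adicSystem J)

end Completion

end

/-! An object `M` of the completion is the limit in the pro-category of its quotients
`D n = M / MJⁿ`, and the universal property of these quotients says that `D m` is `D n / J ^ m D n`
for `m ≤ n`: the quotients form an adic system (`AdicPresentation.adicSystem`). Conversely the
formal limit of every adic system lies in the completion (`AdicSystem.isAdicPro`). Since a pro-object
is the limit of its terms and `Hom(X, c) = colim_α Hom(X_α, c)` for constant `c`, this only needs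
that the transition maps `D n → D m` are surjective with kernel `J ^ m D n`. By the universal
property, morphisms `M ⟶ N` are the same as morphisms between the two adic systems
(`AdicPresentation.homMap_bijective`). In particular, a morphism from `P = lim_n R / J ^ n` to `M`
is an element of the module `lim_n D n` (`AdicPresentation.elemEquiv`).

It remains to see that `D ↦ lim_n D n` is an equivalence from adic systems to finitely generated
modules over `R̂`. The main point is successive approximation (`AdicSystem.exists_eq_sum`): elements
of `lim_n D n` that generate `D 1` generate the limit over `R̂`, and an element vanishing in `D n` is
a combination of them with coefficients vanishing in `R / J ^ n`. Hence the limit is finitely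
generated, and the kernel of `lim_n D n → D n` is `J ^ n (lim_n D n)`, so that linear maps between
limits come from morphisms of systems. For a finitely generated `R̂`-module `N`, the map
`N → lim_n N / J ^ n N` is surjective by the same approximation, and injective by Krull's
intersection theorem, because `R̂` is noetherian, as a quotient of a power series ring over `R`, and
`J R̂` lies in its Jacobson radical (`AdicSystem.toLimit_bijective`).

The equivalence takes `P` to `R̂`, as `End(P) = lim_n R / J ^ n`. So `P` is projective because
epimorphisms of finitely generated modules are surjective, it is a separator because the
equivalence `Hom(P, -)` is faithful, and generators of the module `Hom(P, M)` define an epimorphism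
from a finite direct sum of copies of `P` onto `M`. -/

noncomputable section

/-! ### Maps from a pro-object to a constant one -/

namespace ProCat

variable {R : Type u} [CommRing R] {C : Type w} [Category.{u} C] [Preadditive C] [Linear R C]

/-- Every element of `colim_α Hom_C(X_α, c)` is represented by a morphism `X_α ⟶ c`. -/
theorem exists_rep (X : ProCat R C) {c : C} (x : X.hom.obj c) :
    ∃ (α : X.I) (g : X.diag.obj α ⟶ c), ((X.ι α).app c).hom g = x := by
  have hc := isColimitOfPreserves ((evaluation C (ModuleCat.{u} R)).obj c)
    (colimit.isColimit (X.diag.op ⋙ linearCoyoneda R C))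
  obtain ⟨j, y, hy⟩ := Concrete.isColimit_exists_rep _ hc x
  exact ⟨j.unop, y, hy⟩

/-- Two morphisms `X_α ⟶ c` define the same element of `colim_α Hom_C(X_α, c)` only if they agree
on some refinement of `X_α`. -/
theorem exists_of_rep_eq (X : ProCat R C) {c : C} {α : X.I} {g g' : X.diag.obj α ⟶ c}
    (h : ((X.ι α).app c).hom g = ((X.ι α).app c).hom g') :
    ∃ (α' : X.I) (f f' : α' ⟶ α), X.diag.map f ≫ g = X.diag.map f' ≫ g' := by
  have hc := isColimitOfPreserves ((evaluation C (ModuleCat.{u} R)).obj c)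
    (colimit.isColimit (X.diag.op ⋙ linearCoyoneda R C))
  obtain ⟨k, f, f', h⟩ := Concrete.isColimit_exists_of_rep_eq _ hc
    (i := op α) (j := op α) g g' h
  exact ⟨k.unop, f.unop, f'.unop, h⟩

/-- The formula `Hom(X, c) = colim_α Hom_C(X_α, c)` for a constant pro-object `c`. -/
def toConstEquiv (X : ProCat R C) (c : C) : (X ⟶ (const R C).obj c) ≃ X.hom.obj c where
  toFun f := elem f (Discrete.mk PUnit.unit)
  invFun x := (homEquiv X ((const R C).obj c)).symm ⟨fun _ ↦ x, fun β β' f ↦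
    congr($(X.hom.map_id c).hom x)⟩
  left_inv f := by
    rw [Equiv.symm_apply_eq]
    rfl
  right_inv x := congrFun (congrArg Subtype.val ((homEquiv X ((const R C).obj c)).apply_symm_apply
    ⟨fun _ ↦ x, fun β β' f ↦ congr($(X.hom.map_id c).hom x)⟩)) (Discrete.mk PUnit.unit)

theorem toConstEquiv_add (X : ProCat R C) {c : C} (f g : X ⟶ (const R C).obj c) :
    X.toConstEquiv c (f + g) = X.toConstEquiv c f + X.toConstEquiv c g :=
  rfl

theorem toConstEquiv_smul (X : ProCat R C) {c : C} (r : R) (f : X ⟶ (const R C).obj c) :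
    X.toConstEquiv c (r • f) = r • X.toConstEquiv c f :=
  rfl

theorem toConstEquiv_comp_map (X : ProCat R C) {c d : C} (f : X ⟶ (const R C).obj c) (g : c ⟶ d) :
    X.toConstEquiv d (f ≫ (const R C).map g) = (X.hom.map g).hom (X.toConstEquiv c f) := by
  let cι : (linearCoyoneda R C).obj (op c) ⟶ ((const R C).obj c).hom :=
    ((const R C).obj c).ι (Discrete.mk PUnit.unit)
  let dι : (linearCoyoneda R C).obj (op d) ⟶ ((const R C).obj d).hom :=
    ((const R C).obj d).ι (Discrete.mk PUnit.unit)
  let g' : ((const R C).obj d).hom ⟶ ((const R C).obj c).hom := (const R C).map g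
  let f' : ((const R C).obj c).hom ⟶ X.hom := f
  have h : dι ≫ g' = (linearCoyoneda R C).map g.op ≫ cι :=
    ι_colimMap (G := ((const R C).obj d).diag.op ⋙ linearCoyoneda R C)
      (F := ((const R C).obj c).diag.op ⋙ linearCoyoneda R C)
      (Functor.whiskerRight (NatTrans.op ((Functor.const (Discrete PUnit.{u + 1})).map g))
        (linearCoyoneda R C)) (op (Discrete.mk PUnit.unit))
  refine Eq.trans ?_ (app_eq (cι ≫ f') g)
  have h₁ : ((dι ≫ g').app d).hom (𝟙 d) = ((cι.app d).hom (g ≫ 𝟙 d)) :=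
    congrArg (fun φ : (linearCoyoneda R C).obj (op d) ⟶ ((const R C).obj c).hom ↦
      (φ.app d).hom (𝟙 d)) h
  rw [Category.comp_id] at h₁
  exact congrArg (f'.app d).hom h₁

/-- The projection from a formal inverse limit to a term of the system. -/
def proj (X : ProCat R C) (α : X.I) : X ⟶ (const R C).obj (X.diag.obj α) :=
  (X.toConstEquiv _).symm (((X.ι α).app _).hom (𝟙 _))

theorem toConstEquiv_comp_proj {X Y : ProCat R C} (f : Y ⟶ X) (α : X.I) :
    Y.toConstEquiv _ (f ≫ X.proj α) = elem f α := by
  have h : elem (X.proj α) (Discrete.mk PUnit.unit) = ((X.ι α).app _).hom (𝟙 _) :=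
    (X.toConstEquiv _).apply_symm_apply _
  exact congr(((show X.hom ⟶ Y.hom from f).app (X.diag.obj α)).hom $h)

theorem toConstEquiv_proj_comp_map (X : ProCat R C) {α : X.I} {c : C} (g : X.diag.obj α ⟶ c) :
    X.toConstEquiv c (X.proj α ≫ (const R C).map g) = ((X.ι α).app c).hom g := by
  rw [toConstEquiv_comp_map, app_eq (X.ι α) g]
  congr 1
  exact (X.toConstEquiv _).apply_symm_apply _

/-- Every morphism from a pro-object to a constant one factors through a term of the system. -/
theorem exists_proj_comp_map (X : ProCat R C) {c : C} (f : X ⟶ (const R C).obj c) :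
    ∃ (α : X.I) (g : X.diag.obj α ⟶ c), X.proj α ≫ (const R C).map g = f := by
  obtain ⟨α, g, h⟩ := X.exists_rep (X.toConstEquiv c f)
  exact ⟨α, g, (X.toConstEquiv c).injective ((X.toConstEquiv_proj_comp_map g).trans h)⟩

/-- Morphisms `X_α ⟶ c` that agree on `X` agree on a refinement of `X_α`. -/
theorem exists_of_proj_comp_map_eq (X : ProCat R C) {c : C} {α : X.I}
    {g g' : X.diag.obj α ⟶ c}
    (h : X.proj α ≫ (const R C).map g = X.proj α ≫ (const R C).map g') :
    ∃ (α' : X.I) (f f' : α' ⟶ α), X.diag.map f ≫ g = X.diag.map f' ≫ g' := by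
  refine X.exists_of_rep_eq ?_
  rw [← toConstEquiv_proj_comp_map, h, toConstEquiv_proj_comp_map]

theorem proj_comp_map (X : ProCat R C) {α β : X.I} (f : α ⟶ β) :
    X.proj α ≫ (const R C).map (X.diag.map f) = X.proj β := by
  apply (X.toConstEquiv _).injective
  rw [toConstEquiv_proj_comp_map]
  refine Eq.trans ?_ ((X.toConstEquiv _).apply_symm_apply _).symm
  rw [← ι_map f]
  change _ = ((X.ι α).app _).hom (X.diag.map f ≫ 𝟙 _)
  rw [Category.comp_id]

/-- The index of the unique term of a constant pro-object. -/
def constIndex (c : C) : ((const R C).obj c).I := Discrete.mk PUnit.unit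

theorem proj_const (c : C) : ((const R C).obj c).proj (constIndex c) = 𝟙 ((const R C).obj c) :=
  (((const R C).obj c).toConstEquiv c).symm_apply_eq.mpr rfl

instance : (const R C).Full where
  map_surjective {c d} f := by
    obtain ⟨α, g, hg⟩ := exists_proj_comp_map _ f
    refine ⟨g, Eq.trans ?_ hg⟩
    exact ((Category.id_comp _).symm.trans congr($((proj_const (R := R) c).symm) ≫ _))

instance : (const R C).Faithful where
  map_injective {c d} g g' h := by
    obtain ⟨α, f, f', hf⟩ := exists_of_proj_comp_map_eq ((const R C).obj c)
      (α := constIndex c) (g := g) (g' := g') (congrArg (_ ≫ ·) h)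
    exact (Category.id_comp g).symm.trans (hf.trans (Category.id_comp g'))

instance : (const R C).Additive where
  map_add {c d f g} := by
    apply (toConstEquiv _ d).injective
    rw [toConstEquiv_add, ← Category.id_comp ((const R C).map (f + g)), toConstEquiv_comp_map,
      hom_map_add, ModuleCat.hom_add, LinearMap.add_apply, ← toConstEquiv_comp_map,
      ← toConstEquiv_comp_map, Category.id_comp, Category.id_comp]

instance : (const R C).Linear R where
  map_smul {c d} f r := by
    apply (toConstEquiv _ d).injective
    rw [toConstEquiv_smul, ← Category.id_comp ((const R C).map (r • f)), toConstEquiv_comp_map,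
      hom_map_smul, ModuleCat.hom_smul, LinearMap.smul_apply, ← toConstEquiv_comp_map,
      Category.id_comp]

theorem hom_ext {X Y : ProCat R C} {f g : Y ⟶ X} (h : ∀ α, f ≫ X.proj α = g ≫ X.proj α) :
    f = g := by
  apply (homEquiv Y X).injective
  ext α
  change elem f α = elem g α
  rw [← toConstEquiv_comp_proj, ← toConstEquiv_comp_proj, h]

/-- A pro-object is the limit of the terms of its system. -/
theorem exists_lift (X Y : ProCat R C) (f : ∀ α, Y ⟶ (const R C).obj (X.diag.obj α))
    (hf : ∀ ⦃α β : X.I⦄ (i : α ⟶ β), f α ≫ (const R C).map (X.diag.map i) = f β) :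
    ∃ g : Y ⟶ X, ∀ α, g ≫ X.proj α = f α := by
  refine ⟨(homEquiv Y X).symm ⟨fun α ↦ Y.toConstEquiv _ (f α), fun α β i ↦ ?_⟩, fun α ↦ ?_⟩
  · rw [← toConstEquiv_comp_map, hf]
  · apply (Y.toConstEquiv _).injective
    rw [toConstEquiv_comp_proj]
    exact congrFun (congrArg Subtype.val ((homEquiv Y X).apply_symm_apply _)) α

end ProCat

/-! ### Adic systems and the pro-objects they define -/

variable {R : Type u} [CommRing R]

/-- A linear map factors through a surjective one with smaller kernel. -/
theorem LinearMap.exists_comp_eq_of_ker_le {A B N : Type*} [AddCommGroup A] [Module R A]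
    [AddCommGroup B] [Module R B] [AddCommGroup N] [Module R N] {g : A →ₗ[R] B}
    (hg : Function.Surjective g) {k : A →ₗ[R] N} (h : g.ker ≤ k.ker) :
    ∃ k' : B →ₗ[R] N, k' ∘ₗ g = k := by
  refine ⟨g.ker.liftQ k h ∘ₗ (g.quotKerEquivOfSurjective hg).symm.toLinearMap, ?_⟩
  ext x
  have : (g.quotKerEquivOfSurjective hg).symm (g x) = Submodule.Quotient.mk x := by
    rw [LinearEquiv.symm_apply_eq]
    rfl
  simp [this]

theorem IsQuotientByIdeal.hom_ext {D : Type*} [Category* D] [Preadditive D] [Linear R D]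
    {I : Ideal R} {M Q T : D} {π : M ⟶ Q} (hπ : IsQuotientByIdeal I π) {f g : Q ⟶ T}
    (h : π ≫ f = π ≫ g) : f = g :=
  (hπ.2 (π ≫ f) fun a ha ↦ by rw [← Linear.smul_comp, hπ.1 a ha, zero_comp]).unique rfl h.symm

/-- The transition map `D n → D m` of an inverse system of finitely generated modules. -/
abbrev transition (D : ℕᵒᵖ ⥤ FGModuleCat.{u} R) {m n : ℕ} (h : m ≤ n) :
    D.obj (op n) →ₗ[R] D.obj (op m) :=
  (D.map (homOfLE h).op).hom.hom

theorem transition_self (D : ℕᵒᵖ ⥤ FGModuleCat.{u} R) {n : ℕ} (x : D.obj (op n)) :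
    transition D le_rfl x = x :=
  congr(($(D.map_id (op n))).hom.hom x)

theorem transition_transition (D : ℕᵒᵖ ⥤ FGModuleCat.{u} R) {l m n : ℕ} (h : l ≤ m) (h' : m ≤ n)
    (x : D.obj (op n)) : transition D h (transition D h' x) = transition D (h.trans h') x :=
  congr(($((D.map_comp (homOfLE h').op (homOfLE h).op).symm)).hom.hom x)

/-- A `J`-adic system: an inverse system `(D n)` of finitely generated modules whose transition
maps `D n → D m` identify `D m` with `D n / J ^ m D n`. (For `m = n` this says that
`J ^ n` annihilates `D n`.) -/
structure AdicSystem (J : Ideal R) where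
  /-- the inverse system -/
  diag : ℕᵒᵖ ⥤ FGModuleCat.{u} R
  surjective {m n : ℕ} (h : m ≤ n) : Function.Surjective (transition diag h)
  ker_eq {m n : ℕ} (h : m ≤ n) : (transition diag h).ker = J ^ m • ⊤

/-- A presentation of the pro-object `M` as the limit of its quotients `M / MJⁿ`. -/
structure AdicPresentation (J : Ideal R) (M : ProCat R (FGModuleCat.{u} R)) where
  /-- the quotients `M / MJⁿ` -/
  diag : ℕᵒᵖ ⥤ FGModuleCat.{u} R
  /-- the projections `M ⟶ M / MJⁿ` -/
  π : (Functor.const ℕᵒᵖ).obj M ⟶ diag ⋙ ProCat.const R _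
  isQuotient (n : ℕ) : IsQuotientByIdeal (J ^ n) (π.app (op n))
  /-- `M` is the limit of its quotients -/
  isLimit : IsLimit (Cone.mk M π)

variable {J : Ideal R}

theorem AdicSystem.smul_eq_zero (S : AdicSystem J) {n : ℕ} {a : R} (ha : a ∈ J ^ n)
    (x : S.diag.obj (op n)) : a • x = 0 := by
  have h : a • x ∈ (transition S.diag (le_refl n)).ker := by
    rw [S.ker_eq]
    exact Submodule.smul_mem_smul ha trivial
  rwa [LinearMap.mem_ker, transition_self] at h

namespace AdicPresentation

variable {M : ProCat R (FGModuleCat.{u} R)} (X : AdicPresentation J M)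

/-- The projection `M ⟶ M / MJⁿ`. -/
def proj (n : ℕ) : M ⟶ (ProCat.const R _).obj (X.diag.obj (op n)) :=
  X.π.app (op n)

theorem isQuotient_proj (n : ℕ) : IsQuotientByIdeal (J ^ n) (X.proj n) :=
  X.isQuotient n

theorem proj_map {m n : ℕ} (h : m ≤ n) :
    X.proj n ≫ (ProCat.const R _).map (X.diag.map (homOfLE h).op) = X.proj m :=
  (X.π.naturality (homOfLE h).op).symm.trans (Category.id_comp _)

theorem hom_ext {n : ℕ} {T : FGModuleCat.{u} R} {f g : X.diag.obj (op n) ⟶ T}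
    (h : X.proj n ≫ (ProCat.const R _).map f = X.proj n ≫ (ProCat.const R _).map g) :
    f = g :=
  (ProCat.const R _).map_injective ((X.isQuotient_proj n).hom_ext h)

theorem smul_id_eq_zero {n : ℕ} {a : R} (ha : a ∈ J ^ n) : a • 𝟙 (X.diag.obj (op n)) = 0 := by
  refine X.hom_ext ?_
  rw [Functor.map_smul, Functor.map_zero, CategoryTheory.Functor.map_id, Linear.comp_smul, comp_zero,
    Category.comp_id]
  exact (X.isQuotient_proj n).1 a ha

theorem smul_eq_zero {n : ℕ} {a : R} (ha : a ∈ J ^ n) (x : X.diag.obj (op n)) : a • x = 0 :=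
  congr(($(X.smul_id_eq_zero ha)).hom.hom x)

/-- The universal property of `M / MJⁿ` among modules annihilated by `Jⁿ`. -/
theorem exists_map {n : ℕ} {T : FGModuleCat.{u} R} (g : M ⟶ (ProCat.const R _).obj T)
    (hT : ∀ a ∈ J ^ n, a • 𝟙 T = 0) :
    ∃ h : X.diag.obj (op n) ⟶ T, X.proj n ≫ (ProCat.const R _).map h = g := by
  obtain ⟨h, hh, -⟩ := (X.isQuotient_proj n).2 g fun a ha ↦ by
    rw [← Category.comp_id g, ← Linear.comp_smul, ← CategoryTheory.Functor.map_id,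
      ← Functor.map_smul, hT a ha, Functor.map_zero, comp_zero]
  obtain ⟨k, rfl⟩ := (ProCat.const R _).map_surjective h
  exact ⟨k, hh⟩

/-- Both `M / MJᵐ` and `D n / J ^ m D n`, for `D n = M / MJⁿ`, are universal among the modules
annihilated by `J ^ m` under `M`. -/
theorem ker_eq_and_surjective {m n : ℕ} (h : m ≤ n) :
    (transition X.diag h).ker = J ^ m • ⊤ ∧ Function.Surjective (transition X.diag h) := by
  let N : Submodule R (X.diag.obj (op n)) := J ^ m • ⊤
  have hN : N ≤ (transition X.diag h).ker := by
    refine Submodule.smul_le.mpr fun a ha x _ ↦ ?_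
    rw [LinearMap.mem_ker, map_smul, X.smul_eq_zero ha]
  let q : X.diag.obj (op n) ⟶ FGModuleCat.of R (X.diag.obj (op n) ⧸ N) :=
    FGModuleCat.ofHom N.mkQ
  let r : FGModuleCat.of R (X.diag.obj (op n) ⧸ N) ⟶ X.diag.obj (op m) :=
    FGModuleCat.ofHom (N.liftQ (transition X.diag h) hN)
  have hqr : q ≫ r = X.diag.map (homOfLE h).op := by
    ext x
    rfl
  obtain ⟨k, hk⟩ := X.exists_map (n := m) (X.proj n ≫ (ProCat.const R _).map q)
    fun a ha ↦ by
      ext x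
      exact (Submodule.Quotient.mk_eq_zero N).mpr (Submodule.smul_mem_smul ha trivial)
  have hkq : X.diag.map (homOfLE h).op ≫ k = q := by
    refine X.hom_ext ?_
    rw [← hk, ← X.proj_map h, Functor.map_comp, Category.assoc]
  have hkr : k ≫ r = 𝟙 _ := by
    refine X.hom_ext ?_
    rw [Functor.map_comp, reassoc_of% hk, ← Functor.map_comp, hqr, X.proj_map h,
      CategoryTheory.Functor.map_id, Category.comp_id]
  refine ⟨le_antisymm (fun x hx ↦ ?_) hN, fun y ↦ ?_⟩
  · have hx' : q.hom.hom x = k.hom.hom (transition X.diag h x) := congr(($(hkq)).hom.hom x).symm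
    rw [LinearMap.mem_ker.mp hx, map_zero] at hx'
    exact (Submodule.Quotient.mk_eq_zero N).mp hx'
  · obtain ⟨x, hx⟩ := N.mkQ_surjective (k.hom.hom y)
    refine ⟨x, ?_⟩
    have hy : r.hom.hom (k.hom.hom y) = y := congr(($(hkr)).hom.hom y)
    rw [← hx] at hy
    exact hy

/-- The quotients `M / MJⁿ` of an object of the completion form an adic system. -/
@[simps diag]
def adicSystem : AdicSystem J where
  diag := X.diag
  surjective h := (X.ker_eq_and_surjective h).2
  ker_eq h := (X.ker_eq_and_surjective h).1

end AdicPresentation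

namespace AdicSystem

variable (S : AdicSystem J)

/-- The formal inverse limit of an adic system. -/
def pro : ProCat R (FGModuleCat.{u} R) :=
  (ProCat.lim R (ULift.{u} ℕ)ᵒᵖ).obj
    ((Monotone.functor (f := (ULift.down : ULift.{u} ℕ → ℕ)) fun _ _ h ↦ h).op ⋙ S.diag)

/-- The projection from the formal inverse limit of an adic system to its `n`-th term. -/
def proj (n : ℕ) : S.pro ⟶ (ProCat.const R _).obj (S.diag.obj (op n)) :=
  ProCat.proj S.pro (op (ULift.up n))

theorem proj_map {m n : ℕ} (h : m ≤ n) :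
    S.proj n ≫ (ProCat.const R _).map (S.diag.map (homOfLE h).op) = S.proj m :=
  ProCat.proj_comp_map S.pro (α := op (ULift.up n)) (β := op (ULift.up m))
    (homOfLE (show ULift.up m ≤ ULift.up n from h)).op

theorem exists_proj_comp_map {T : FGModuleCat.{u} R} (g : S.pro ⟶ (ProCat.const R _).obj T)
    (n : ℕ) : ∃ (m : ℕ) (_ : n ≤ m) (k : S.diag.obj (op m) ⟶ T),
      S.proj m ≫ (ProCat.const R _).map k = g := by
  obtain ⟨⟨⟨m⟩⟩, k, hk⟩ := ProCat.exists_proj_comp_map S.pro g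
  change S.diag.obj (op m) ⟶ T at k
  refine ⟨max n m, le_max_left _ _, S.diag.map (homOfLE (le_max_right n m)).op ≫ k, ?_⟩
  rw [Functor.map_comp, ← Category.assoc, S.proj_map]
  exact hk

/-- The projections from the limit of an adic system are epimorphisms with respect to constant
pro-objects, since the transition maps are surjective. -/
theorem proj_hom_ext {n : ℕ} {T : FGModuleCat.{u} R} {f g : S.diag.obj (op n) ⟶ T}
    (h : S.proj n ≫ (ProCat.const R _).map f = S.proj n ≫ (ProCat.const R _).map g) :
    f = g := by
  obtain ⟨⟨⟨m⟩⟩, i, i', hm⟩ := ProCat.exists_of_proj_comp_map_eq S.pro h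
  ext x
  obtain ⟨x, rfl⟩ := S.surjective (show ULift.up.{u} n ≤ ULift.up m from leOfHom i.unop) x
  exact congr(($(hm)).hom.hom x)

theorem smul_id_eq_zero {n : ℕ} {a : R} (ha : a ∈ J ^ n) : a • 𝟙 (S.diag.obj (op n)) = 0 := by
  ext x
  exact S.smul_eq_zero ha x

/-- The universal property of the `n`-th term among constant pro-objects. As `D m → D n` is
surjective with kernel `J ^ n D m`, a map `D m ⟶ T` annihilated by `J ^ n` factors through `D n`. -/
theorem existsUnique_map {n : ℕ} {T : FGModuleCat.{u} R} (g : S.pro ⟶ (ProCat.const R _).obj T)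
    (hg : ∀ a ∈ J ^ n, a • g = 0) :
    ∃! h : S.diag.obj (op n) ⟶ T, S.proj n ≫ (ProCat.const R _).map h = g := by
  obtain ⟨m, hm, k, rfl⟩ := S.exists_proj_comp_map g n
  have hk : (transition S.diag hm).ker ≤ k.hom.hom.ker := by
    rw [S.ker_eq]
    refine Submodule.smul_le.mpr fun a ha x _ ↦ ?_
    have h := hg a ha
    rw [← Linear.comp_smul, ← Functor.map_smul, ← comp_zero (f := S.proj m),
      ← Functor.map_zero (ProCat.const R _)] at h
    rw [LinearMap.mem_ker, map_smul]
    exact congr(($(S.proj_hom_ext h)).hom.hom x)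
  obtain ⟨k', hk'⟩ := LinearMap.exists_comp_eq_of_ker_le (S.surjective hm) hk
  replace hk' : S.diag.map (homOfLE hm).op ≫ FGModuleCat.ofHom k' = k := FGModuleCat.hom_ext hk'
  refine ⟨FGModuleCat.ofHom k', ?_, fun h hh ↦ S.proj_hom_ext ?_⟩
  · simp only
    rw [← S.proj_map hm, Category.assoc, ← Functor.map_comp, hk']
  · rw [hh, ← S.proj_map hm, Category.assoc, ← Functor.map_comp, hk']

theorem isQuotientByIdeal_proj (n : ℕ) : IsQuotientByIdeal (J ^ n) (S.proj n) := by
  refine ⟨fun a ha ↦ ?_, fun T g hg ↦ ?_⟩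
  · rw [← Category.comp_id (S.proj n), ← Linear.comp_smul, ← CategoryTheory.Functor.map_id,
      ← Functor.map_smul, S.smul_id_eq_zero ha, Functor.map_zero, comp_zero]
  · -- `T` is a limit of constant pro-objects, so it suffices to factor its coordinates.
    have H (β : T.I) := S.existsUnique_map (n := n) (g ≫ T.proj β) fun a ha ↦ by
      rw [← Linear.smul_comp, hg a ha, zero_comp]
    choose h hh huniq using H
    obtain ⟨l, hl⟩ := T.exists_lift _ (fun β ↦ (ProCat.const R _).map (h β)) fun β β' i ↦ by
      rw [← Functor.map_comp]
      congr 1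
      apply huniq
      rw [Functor.map_comp, reassoc_of% (hh β), ProCat.proj_comp_map]
    refine ⟨l, ProCat.hom_ext fun β ↦ ?_, fun l' hl' ↦ ProCat.hom_ext fun β ↦ ?_⟩
    · rw [Category.assoc, hl]
      exact hh β
    · obtain ⟨k, hk⟩ := (ProCat.const R _).map_surjective (l' ≫ T.proj β)
      rw [← hk, hl]
      congr 1
      apply huniq
      rw [hk, ← Category.assoc, hl']

/-- The formal inverse limit of an adic system is its limit in the category of pro-objects. -/
theorem existsUnique_lift (Y : ProCat R (FGModuleCat.{u} R))
    (f : ∀ n : ℕ, Y ⟶ (ProCat.const R _).obj (S.diag.obj (op n)))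
    (hf : ∀ ⦃m n : ℕ⦄ (h : m ≤ n),
      f n ≫ (ProCat.const R _).map (S.diag.map (homOfLE h).op) = f m) :
    ∃! g : Y ⟶ S.pro, ∀ n, g ≫ S.proj n = f n := by
  obtain ⟨g, hg⟩ := S.pro.exists_lift Y (fun α : (ULift.{u} ℕ)ᵒᵖ ↦ f α.unop.down)
    fun (α β : (ULift.{u} ℕ)ᵒᵖ) i ↦ hf (show β.unop ≤ α.unop from leOfHom i.unop)
  exact ⟨g, fun n ↦ hg (op (ULift.up n)), fun g' hg' ↦ ProCat.hom_ext fun α : (ULift.{u} ℕ)ᵒᵖ ↦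
    (hg' α.unop.down).trans (hg α).symm⟩

/-- The presentation of the formal inverse limit of an adic system by the terms of the system. -/
@[simps diag]
def presentation : AdicPresentation J S.pro where
  diag := S.diag
  π :=
    { app n := S.proj n.unop
      naturality n m i := (Category.id_comp _).trans (S.proj_map (leOfHom i.unop)).symm }
  isQuotient n := S.isQuotientByIdeal_proj n
  isLimit := IsLimit.ofExistsUnique fun s ↦ by
    obtain ⟨g, hg, hg'⟩ := S.existsUnique_lift s.pt (fun n ↦ s.π.app (op n)) fun m n h ↦
      s.w (homOfLE h).op
    exact ⟨g, fun n ↦ hg n.unop, fun l hl ↦ hg' l fun n ↦ hl (op n)⟩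

theorem isAdicPro : IsAdicPro J (FGModuleCat.{u} R) S.pro :=
  ⟨S.diag, S.presentation.π, S.presentation.isQuotient, ⟨S.presentation.isLimit⟩⟩

end AdicSystem

/-! ### The limit of an adic system as a module over the completed ring -/

namespace AdicCompletion

theorem evalₐ_eq_mk_of_le {r : AdicCompletion J R} {m n : ℕ} (h : m ≤ n) {a : R}
    (hr : evalₐ J n r = Ideal.Quotient.mk _ a) : evalₐ J m r = Ideal.Quotient.mk _ a := by
  obtain ⟨s, rfl⟩ := mk_surjective J R r
  rw [evalₐ_mk] at hr ⊢
  rw [← Ideal.mk_eq_mk J h, Ideal.Quotient.eq]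
  exact Ideal.pow_le_pow_right h (Ideal.Quotient.eq.mp hr)

/-- A representative in `R` of the image of `r` in `R / J ^ n`. -/
def rep (r : AdicCompletion J R) (n : ℕ) : R := (evalₐ J n r).out

theorem evalₐ_eq_mk_rep (r : AdicCompletion J R) (n : ℕ) :
    evalₐ J n r = Ideal.Quotient.mk _ (r.rep n) :=
  (Ideal.Quotient.mk_out _).symm

end AdicCompletion

open AdicCompletion

namespace AdicSystem

variable (S T : AdicSystem J)

theorem smul_congr {n : ℕ} {a b : R}
    (h : (Ideal.Quotient.mk (J ^ n) a) = Ideal.Quotient.mk _ b) (x : S.diag.obj (op n)) :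
    a • x = b • x := by
  rw [← sub_eq_zero, ← sub_smul]
  exact S.smul_eq_zero (Ideal.Quotient.eq.mp h) x

/-- The limit `lim_n D n` of an adic system in the category of modules, as the module of
compatible families. -/
def limit : Submodule R (∀ n, S.diag.obj (op n)) where
  carrier := {x | ∀ ⦃m n : ℕ⦄ (h : m ≤ n), transition S.diag h (x n) = x m}
  add_mem' hx hy m n h := by
    rw [Pi.add_apply, map_add, hx h, hy h, Pi.add_apply]
  zero_mem' m n h := map_zero _
  smul_mem' a x hx m n h := by
    rw [Pi.smul_apply, map_smul, hx h, Pi.smul_apply]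

variable {S T}

theorem limit_ext {x y : S.limit} (h : ∀ n, x.1 n = y.1 n) : x = y :=
  Subtype.ext (funext h)

theorem transition_apply (x : S.limit) {m n : ℕ} (h : m ≤ n) :
    transition S.diag h (x.1 n) = x.1 m :=
  x.2 h

variable (S) in
/-- The projection from the limit of an adic system to its `n`-th term. -/
def eval (n : ℕ) : S.limit →ₗ[R] S.diag.obj (op n) :=
  LinearMap.proj (φ := fun n ↦ (S.diag.obj (op n) : Type u)) n ∘ₗ S.limit.subtype

theorem eval_apply (n : ℕ) (x : S.limit) : S.eval n x = x.1 n :=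
  rfl

/-- The completed ring acts on the `n`-th term of an adic system through `R / J ^ n`. -/
instance : SMul (AdicCompletion J R) S.limit where
  smul r x := ⟨fun n ↦ r.rep n • x.1 n, fun m n h ↦ by
    rw [map_smul, transition_apply]
    exact S.smul_congr ((evalₐ_eq_mk_of_le h (r.evalₐ_eq_mk_rep n)).symm.trans
      (r.evalₐ_eq_mk_rep m)) _⟩

theorem smul_apply {r : AdicCompletion J R} {n : ℕ} {a : R}
    (h : evalₐ J n r = Ideal.Quotient.mk _ a) (x : S.limit) : (r • x).1 n = a • x.1 n :=
  S.smul_congr ((r.evalₐ_eq_mk_rep n).symm.trans h) _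

instance : Module (AdicCompletion J R) S.limit where
  one_smul x := limit_ext fun n ↦ by
    rw [smul_apply (a := 1) (by simp), one_smul]
  mul_smul r s x := limit_ext fun n ↦ by
    rw [smul_apply (a := r.rep n * s.rep n)
      (by rw [map_mul, map_mul, evalₐ_eq_mk_rep, evalₐ_eq_mk_rep]),
      smul_apply (r.evalₐ_eq_mk_rep n), smul_apply (s.evalₐ_eq_mk_rep n), mul_smul]
  smul_zero r := limit_ext fun n ↦ smul_zero _
  smul_add r x y := limit_ext fun n ↦ smul_add _ _ _
  add_smul r s x := limit_ext fun n ↦ by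
    rw [smul_apply (a := r.rep n + s.rep n)
      (by rw [map_add, map_add, evalₐ_eq_mk_rep, evalₐ_eq_mk_rep]), add_smul]
    rfl
  zero_smul x := limit_ext fun n ↦ by
    rw [smul_apply (a := 0) (by simp), zero_smul]
    rfl

theorem algebraMap_smul_eq (a : R) (x : S.limit) :
    algebraMap R (AdicCompletion J R) a • x = a • x :=
  limit_ext fun _ ↦ smul_apply (AlgHom.commutes _ _) x

instance : IsScalarTower R (AdicCompletion J R) S.limit :=
  .of_algebraMap_smul algebraMap_smul_eq

/-- Elements lift from `D n` to the limit, one transition map at a time. -/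
theorem eval_surjective (n : ℕ) : Function.Surjective (S.eval n) := by
  intro y
  have H (k : ℕ) := S.surjective (Nat.le_succ (n + k))
  choose f hf using H
  let z : ∀ k, S.diag.obj (op (n + k)) := fun k ↦ Nat.rec y (fun k x ↦ f k x) k
  have hz (k l : ℕ) (h : k ≤ l) :
      transition S.diag (Nat.add_le_add_left h n) (z l) = z k := by
    induction l, h using Nat.le_induction with
    | base => exact transition_self _ _
    | succ l h ih =>
      rw [← ih, ← hf l (z l), transition_transition]
  refine ⟨⟨fun k ↦ transition S.diag (Nat.le_add_left k n) (z k), fun k l h ↦ ?_⟩, ?_⟩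
  · simp only
    rw [transition_transition, ← hz k l h, transition_transition]
  · exact hz 0 n n.zero_le

/-- One step of successive approximation: elements generating `D 1` generate the kernel
`J ^ m D (m + 1)` of `D (m + 1) → D m` with coefficients in `J ^ m`. -/
theorem exists_approx_step {ι : Type*} [Fintype ι] {d : ι → S.limit}
    (hd : Submodule.span R (Set.range fun i ↦ (d i).1 1) = ⊤) {m : ℕ} {y : S.limit}
    (hy : y.1 m = 0) :
    ∃ c : ι → R, (∀ i, c i ∈ J ^ m) ∧ (y - ∑ i, c i • d i).1 (m + 1) = 0 := by
  let N : Submodule R (S.diag.obj (op (m + 1))) :=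
    Submodule.span R (Set.range fun i ↦ (d i).1 (m + 1))
  have h1 : 1 ≤ m + 1 := Nat.le_add_left 1 m
  have hN : N.map (transition S.diag h1) = ⊤ := by
    rw [Submodule.map_span, ← Set.range_comp, ← hd]
    congr 2
    ext i
    exact transition_apply (d i) h1
  have htop : (⊤ : Submodule R (S.diag.obj (op (m + 1)))) ≤ N ⊔ J ^ 1 • ⊤ := by
    intro z _
    obtain ⟨w, hw, hwz⟩ : transition S.diag h1 z ∈ N.map (transition S.diag h1) := hN ▸ trivial
    rw [← add_sub_cancel w z]
    refine Submodule.add_mem_sup hw ?_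
    rw [← S.ker_eq h1, LinearMap.mem_ker, map_sub, hwz, sub_self]
  have hy' : y.1 (m + 1) ∈ J ^ m • N := by
    have h : y.1 (m + 1) ∈ J ^ m • (⊤ : Submodule R (S.diag.obj (op (m + 1)))) := by
      rw [← S.ker_eq m.le_succ, LinearMap.mem_ker, transition_apply, hy]
    have h' := Submodule.smul_mono (le_refl (J ^ m)) htop h
    -- `J ^ m • J • ⊤` vanishes in `D (m + 1)`
    have h0 : (J ^ (m + 1) • ⊤ : Submodule R (S.diag.obj (op (m + 1)))) = ⊥ := by
      rw [← S.ker_eq le_rfl]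
      exact LinearMap.ker_eq_bot'.mpr fun z hz ↦ (transition_self _ z).symm.trans hz
    rwa [Submodule.smul_sup, ← Submodule.mul_smul, ← pow_add, h0, sup_bot_eq] at h'
  obtain ⟨a, ha, hay⟩ := (Submodule.mem_ideal_smul_span_iff_exists_sum _ _ _).mp hy'
  refine ⟨a, ha, ?_⟩
  rw [← eval_apply, map_sub, map_sum, eval_apply, ← hay, Finsupp.sum_fintype _ _ (by simp),
    sub_eq_zero]
  simp only [map_smul, eval_apply]

/-- Elements of the limit whose images generate `D 1` generate the limit over the completed ring,
and the coefficients of an element vanishing in `D n` can be chosen to vanish in `R / J ^ n`. -/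
theorem exists_eq_sum {ι : Type*} [Fintype ι] {d : ι → S.limit}
    (hd : Submodule.span R (Set.range fun i ↦ (d i).1 1) = ⊤) {n : ℕ} {x : S.limit}
    (hx : x.1 n = 0) :
    ∃ c : ι → AdicCompletion J R, (∀ i, evalₐ J n (c i) = 0) ∧ x = ∑ i, c i • d i := by
  -- `s k` are coefficients approximating `x` in `D (n + k)`; they form Cauchy sequences.
  have H (k : ℕ) (s : {s : ι → R // (x - ∑ i, s i • d i).1 (n + k) = 0}) :
      ∃ s' : {s : ι → R // (x - ∑ i, s i • d i).1 (n + (k + 1)) = 0},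
        ∀ i, s'.1 i - s.1 i ∈ J ^ (n + k) := by
    obtain ⟨c, hc, h⟩ := exists_approx_step hd s.2
    refine ⟨⟨s.1 + c, ?_⟩, fun i ↦ by simpa using hc i⟩
    simp only [Pi.add_apply, add_smul, Finset.sum_add_distrib, ← sub_sub]
    exact h
  choose f hf using H
  let s (k : ℕ) : {s : ι → R // (x - ∑ i, s i • d i).1 (n + k) = 0} :=
    Nat.rec ⟨0, by simpa using hx⟩ f k
  have hs (k : ℕ) (i : ι) : (s (k + 1)).1 i - (s k).1 i ∈ J ^ (n + k) := hf k (s k) i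
  have hsn (k : ℕ) (i : ι) : (s k).1 i ∈ J ^ n := by
    induction k with
    | zero => exact zero_mem _
    | succ k ih =>
      rw [← sub_add_cancel ((s (k + 1)).1 i) ((s k).1 i)]
      exact add_mem (Ideal.pow_le_pow_right (Nat.le_add_right n k) (hs k i)) ih
  let c (i : ι) : AdicCompletion J R := AdicCompletion.mk J R
    (AdicCauchySequence.mk J R (fun k ↦ (s k).1 i) fun k ↦ by
      rw [SModEq.comm, SModEq.sub_mem, smul_eq_mul, Ideal.mul_top]
      exact Ideal.pow_le_pow_right (Nat.le_add_left k n) (hs k i))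
  have hc (i : ι) (k : ℕ) : evalₐ J k (c i) = Ideal.Quotient.mk _ ((s k).1 i) := evalₐ_mk _ _ _
  refine ⟨c, fun i ↦ ?_, limit_ext fun k ↦ ?_⟩
  · rw [hc]
    exact Ideal.Quotient.eq_zero_iff_mem.mpr (hsn n i)
  · have h : S.eval k x = S.eval k (∑ i, (s k).1 i • d i) := by
      rw [← sub_eq_zero, ← map_sub, eval_apply, ← transition_apply _ (Nat.le_add_left k n),
        (s k).2, _root_.map_zero]
    rw [← eval_apply, h, ← eval_apply, map_sum, map_sum]
    refine Finset.sum_congr rfl fun i _ ↦ ?_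
    rw [eval_apply, eval_apply, smul_apply (hc i k)]
    rfl

theorem apply_zero_eq (x : S.limit) : x.1 0 = 0 := by
  rw [← one_smul R (x.1 0)]
  exact S.smul_eq_zero (by simp) _

/-- Elements whose images generate `D 1` generate the limit over the completed ring. -/
theorem span_eq_top_of_span_eval_one_eq_top {ι : Type*} [Fintype ι] {d : ι → S.limit}
    (hd : Submodule.span R (Set.range fun i ↦ (d i).1 1) = ⊤) :
    Submodule.span (AdicCompletion J R) (Set.range d) = ⊤ := by
  refine eq_top_iff.mpr fun x _ ↦ ?_
  obtain ⟨c, -, rfl⟩ := exists_eq_sum hd (apply_zero_eq x)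
  exact sum_mem fun i _ ↦ Submodule.smul_mem _ _ (Submodule.subset_span ⟨i, rfl⟩)

variable (S) in
theorem exists_generators : ∃ (t : ℕ) (d : Fin t → S.limit),
    Submodule.span R (Set.range fun i ↦ (d i).1 1) = ⊤ := by
  obtain ⟨t, d, hd⟩ := Module.Finite.exists_fin (R := R) (M := S.diag.obj (op 1))
  choose d' hd' using fun i ↦ S.eval_surjective 1 (d i)
  refine ⟨t, d', ?_⟩
  rw [← hd]
  congr 2
  ext i
  exact hd' i

instance : Module.Finite (AdicCompletion J R) S.limit := by
  obtain ⟨t, d, hd⟩ := S.exists_generators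
  exact ⟨(Set.finite_range d).toFinset, by
    rw [Set.Finite.coe_toFinset, span_eq_top_of_span_eval_one_eq_top hd]⟩

/-- If `J` is finitely generated, then the kernel of `lim_n D n → D n` is `J ^ n (lim_n D n)`. -/
theorem ker_eval (hJ : J.FG) (n : ℕ) : (S.eval n).ker = J ^ n • ⊤ := by
  refine le_antisymm (fun x hx ↦ ?_) (Submodule.smul_le.mpr fun a ha x _ ↦ ?_)
  · obtain ⟨t, d, hd⟩ := S.exists_generators
    obtain ⟨c, hc, rfl⟩ := exists_eq_sum hd hx
    refine sum_mem fun i _ ↦ ?_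
    have h : c i ∈ (J ^ n • ⊤ : Submodule R (AdicCompletion J R)) := by
      rw [pow_smul_top_eq_ker_eval hJ, LinearMap.mem_ker,
        ← factor_evalₐ_eq_eval J _ (by simp), hc i, _root_.map_zero]
    have h' := Submodule.mem_map_of_mem
      (f := (LinearMap.toSpanSingleton (AdicCompletion J R) S.limit (d i)).restrictScalars R) h
    rw [Submodule.map_smul''] at h'
    exact Submodule.smul_mono le_rfl le_top h'
  · rw [LinearMap.mem_ker, map_smul]
    exact S.smul_eq_zero ha _

/-- The map on limits induced by a morphism of adic systems. -/
def limitMap (φ : S.diag ⟶ T.diag) : S.limit →ₗ[AdicCompletion J R] T.limit where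
  toFun x := ⟨fun n ↦ (φ.app (op n)).hom.hom (x.1 n), fun m n h ↦ by
    simp only [← transition_apply x h]
    exact congr(($((φ.naturality (homOfLE h).op).symm)).hom.hom (x.1 n))⟩
  map_add' x y := limit_ext fun n ↦ map_add _ _ _
  map_smul' r x := limit_ext fun n ↦ map_smul _ _ _

theorem limitMap_injective {φ ψ : S.diag ⟶ T.diag} (h : limitMap φ = limitMap ψ) : φ = ψ := by
  ext ⟨n⟩ x
  obtain ⟨x, rfl⟩ := S.eval_surjective n x
  exact congrFun (congrArg Subtype.val (LinearMap.congr_fun h x)) n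

/-- Linear maps between the limits of adic systems come from morphisms of the systems. -/
theorem limitMap_surjective (hJ : J.FG) (f : S.limit →ₗ[AdicCompletion J R] T.limit) :
    ∃ φ : S.diag ⟶ T.diag, limitMap φ = f := by
  have H (n : ℕ) := LinearMap.exists_comp_eq_of_ker_le (S.eval_surjective n)
    (k := T.eval n ∘ₗ f.restrictScalars R) (by
      rw [ker_eval hJ]
      refine Submodule.smul_le.mpr fun a ha x _ ↦ ?_
      rw [LinearMap.mem_ker, map_smul]
      exact T.smul_eq_zero ha _)
  choose g hg using H
  have hg' (n : ℕ) (x : S.limit) : g n (x.1 n) = (f x).1 n := LinearMap.congr_fun (hg n) x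
  refine ⟨{ app n := FGModuleCat.ofHom (g n.unop), naturality n m i := ?_ }, ?_⟩
  · ext x
    obtain ⟨x, rfl⟩ := S.eval_surjective n.unop x
    change g m.unop (transition S.diag (leOfHom i.unop) (x.1 n.unop)) =
      transition T.diag (leOfHom i.unop) (g n.unop (x.1 n.unop))
    rw [transition_apply, hg', hg', transition_apply]
  · exact LinearMap.ext fun x ↦ limit_ext fun n ↦ hg' n x

end AdicSystem

/-! ### Noetherianity of the completed ring -/

namespace AdicCompletion

theorem sub_algebraMap_mem_of_evalₐ_eq (hJ : J.FG) {r : AdicCompletion J R} {n : ℕ} {a : R}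
    (h : evalₐ J n r = Ideal.Quotient.mk _ a) :
    r - algebraMap R (AdicCompletion J R) a ∈ (J ^ n • ⊤ : Submodule R (AdicCompletion J R)) := by
  rw [pow_smul_top_eq_ker_eval hJ, LinearMap.mem_ker, ← factor_evalₐ_eq_eval J _ (by simp), map_sub,
    h, AlgHom.commutes]
  simp

/-- The completion of a noetherian ring `R` is noetherian: if `a₁, …, a_k` generate `J`, then it is
a quotient of the ring of power series over `R` in `k` variables, by `X_i ↦ a_i`. -/
theorem isNoetherianRing [IsNoetherianRing R] : IsNoetherianRing (AdicCompletion J R) := by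
  have hJ : J.FG := IsNoetherian.noetherian J
  obtain ⟨k, a, ha⟩ := Submodule.fg_iff_exists_fin_generating_family.mp hJ
  let A := MvPolynomial (Fin k) R
  let I : Ideal A := MvPolynomial.idealOfVars (Fin k) R
  let f : A →+* R := (MvPolynomial.aeval a : A →ₐ[R] R)
  have hI : I.map f = J := by
    rw [← ha, ← Ideal.span]
    simp only [I, MvPolynomial.idealOfVars, Ideal.map_span, ← Set.range_comp]
    congr 2
    ext i
    exact MvPolynomial.aeval_X a i
  have hIn (n : ℕ) : I ^ n ≤ (J ^ n).comap f := by
    rw [← hI, ← Ideal.map_pow]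
    exact Ideal.le_comap_map
  have : IsNoetherianRing (AdicCompletion I A) :=
    isNoetherianRing_of_ringEquiv _ (MvPowerSeries.toAdicCompletionAlgEquiv (Fin k) R).toRingEquiv
  let F : AdicCompletion I A →+* AdicCompletion J R := liftRingHom J
    (fun n ↦ (Ideal.quotientMap (J ^ n) f (hIn n)).comp (evalₐ I n : _ →+* _)) fun {m n} h ↦ by
      ext x
      obtain ⟨s, rfl⟩ := mk_surjective I A x
      simp only [RingHom.comp_apply, RingHom.coe_coe, evalₐ_mk, Ideal.quotientMap_mk,
        ← Ideal.mk_eq_mk I h]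
      rfl
  have hF : F.comp (algebraMap A (AdicCompletion I A)) =
      (algebraMap R (AdicCompletion J R)).comp f := by
    refine RingHom.ext fun x ↦ ext_evalₐ fun n ↦ ?_
    simp only [RingHom.comp_apply, F, evalₐ_liftRingHom, RingHom.coe_coe, AlgHom.commutes]
    rfl
  have hIF : (I.map (algebraMap A (AdicCompletion I A))).map F =
      J.map (algebraMap R (AdicCompletion J R)) := by
    rw [Ideal.map_map, hF, ← Ideal.map_map, hI]
  have := isAdicComplete_self I (MvPolynomial.idealOfVars_fg (Fin k) R)
  have := isAdicComplete_self J hJ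
  have : IsHausdorff ((I.map (algebraMap A (AdicCompletion I A))).map F) (AdicCompletion J R) := by
    rw [hIF]
    infer_instance
  refine isNoetherianRing_of_surjective _ _ F (surjective_of_mk_map_comp_surjective F
    (I := I.map (algebraMap A (AdicCompletion I A))) fun y ↦ ?_)
  obtain ⟨y, rfl⟩ := Ideal.Quotient.mk_surjective y
  refine ⟨algebraMap A _ (MvPolynomial.C (y.rep 1)), ?_⟩
  have h := congr($hF (MvPolynomial.C (y.rep 1)))
  simp only [RingHom.comp_apply] at h ⊢
  rw [h, eq_comm, Ideal.Quotient.eq, hIF]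
  have h' := sub_algebraMap_mem_of_evalₐ_eq hJ (y.evalₐ_eq_mk_rep 1)
  rw [Ideal.smul_top_eq_map, pow_one] at h'
  have hfC : f (MvPolynomial.C (y.rep 1)) = y.rep 1 := MvPolynomial.aeval_C a _
  rwa [hfC]

end AdicCompletion

/-! ### The adic system of a finitely generated module over the completed ring -/

section OfModule

variable (N : Type u) [AddCommGroup N] [Module (AdicCompletion J R) N] [Module R N]
  [IsScalarTower R (AdicCompletion J R) N]

/-- The completed ring acts on `N / J ^ n N` through `R / J ^ n`. -/
theorem AdicCompletion.mkQ_smul_eq (hJ : J.FG) {n : ℕ} {r : AdicCompletion J R} {a : R}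
    (h : evalₐ J n r = Ideal.Quotient.mk _ a) (x : N) :
    (J ^ n • ⊤ : Submodule R N).mkQ (r • x) = a • (J ^ n • ⊤ : Submodule R N).mkQ x := by
  rw [← map_smul, ← sub_eq_zero, ← map_sub, Submodule.mkQ_apply, Submodule.Quotient.mk_eq_zero,
    ← algebraMap_smul (AdicCompletion J R) a x, ← sub_smul]
  have h' := Submodule.mem_map_of_mem
    (f := (LinearMap.toSpanSingleton (AdicCompletion J R) N x).restrictScalars R)
    (sub_algebraMap_mem_of_evalₐ_eq hJ h)
  rw [Submodule.map_smul''] at h'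
  exact Submodule.smul_mono le_rfl le_top h'

theorem AdicCompletion.span_range_mkQ_eq_top (hJ : J.FG) {ι : Type*} [Fintype ι] {d : ι → N}
    (hd : Submodule.span (AdicCompletion J R) (Set.range d) = ⊤) (n : ℕ) :
    Submodule.span R (Set.range fun i ↦ (J ^ n • ⊤ : Submodule R N).mkQ (d i)) = ⊤ := by
  refine eq_top_iff.mpr fun x _ ↦ ?_
  obtain ⟨x, rfl⟩ := Submodule.mkQ_surjective _ x
  obtain ⟨c, rfl⟩ := (Submodule.mem_span_range_iff_exists_fun _).mp (hd ▸ trivial :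
    x ∈ Submodule.span (AdicCompletion J R) (Set.range d))
  rw [map_sum]
  refine sum_mem fun i _ ↦ ?_
  rw [mkQ_smul_eq N hJ ((c i).evalₐ_eq_mk_rep n)]
  exact Submodule.smul_mem _ _ (Submodule.subset_span ⟨i, rfl⟩)

variable [Module.Finite (AdicCompletion J R) N]

theorem AdicCompletion.finite_quotient (hJ : J.FG) (n : ℕ) : Module.Finite R (N ⧸ (J ^ n • ⊤ : Submodule R N)) := by
  obtain ⟨t, d, hd⟩ := Module.Finite.exists_fin (R := AdicCompletion J R) (M := N)
  exact ⟨(Set.finite_range _).toFinset, by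
    rw [Set.Finite.coe_toFinset, span_range_mkQ_eq_top N hJ hd n]⟩

/-- The adic system `N / J ^ n N` attached to a finitely generated module `N` over the completed
ring. -/
def AdicSystem.ofModule (hJ : J.FG) : AdicSystem J where
  diag :=
    { obj n :=
        haveI := finite_quotient N hJ n.unop
        FGModuleCat.of R (N ⧸ (J ^ n.unop • ⊤ : Submodule R N))
      map {n m} i :=
        haveI := finite_quotient N hJ n.unop
        haveI := finite_quotient N hJ m.unop
        FGModuleCat.ofHom (Submodule.factorPow J N (leOfHom i.unop))
      map_id n := by
        apply FGModuleCat.hom_ext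
        apply LinearMap.ext
        intro x
        obtain ⟨x, rfl⟩ := Submodule.mkQ_surjective _ x
        rfl
      map_comp i j := FGModuleCat.hom_ext (Submodule.factor_comp
        (Submodule.smul_mono_left (Ideal.pow_le_pow_right (leOfHom i.unop)))
        (Submodule.smul_mono_left (Ideal.pow_le_pow_right (leOfHom j.unop)))).symm }
  surjective h := Submodule.factor_surjective
    (Submodule.smul_mono_left (Ideal.pow_le_pow_right h))
  ker_eq {m n} h := by
    let N' : Submodule R N := J ^ n • ⊤
    have hq (y : N) : N'.mkQ y ∈ (J ^ m • ⊤ : Submodule R (N ⧸ N')) ↔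
        (J ^ m • ⊤ : Submodule R N).mkQ y = 0 := by
      rw [← Submodule.range_mkQ N', LinearMap.range_eq_map, ← Submodule.map_smul'',
        ← Submodule.mem_comap, Submodule.comap_map_mkQ, sup_eq_right.mpr
          (Submodule.smul_mono_left (Ideal.pow_le_pow_right h)), Submodule.mkQ_apply,
        Submodule.Quotient.mk_eq_zero]
    ext x
    obtain ⟨y, rfl⟩ := N'.mkQ_surjective x
    exact (hq y).symm

/-- The canonical map from a module `N` over the completed ring to `lim_n N / J ^ n N`. -/
def AdicSystem.toLimit (hJ : J.FG) : N →ₗ[AdicCompletion J R] (ofModule N hJ).limit where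
  toFun y := ⟨fun n ↦ (J ^ n • ⊤ : Submodule R N).mkQ y, fun _ _ _ ↦ rfl⟩
  map_add' _ _ := rfl
  map_smul' r y := limit_ext fun n ↦ mkQ_smul_eq N hJ (r.evalₐ_eq_mk_rep n) y

/-- A finitely generated module `N` over the completion of a noetherian ring is the limit of its
quotients `N / J ^ n N`: the canonical map is injective by Krull's intersection theorem, and
surjective since generators of `N` generate `N / J N`. -/
theorem AdicSystem.toLimit_bijective [IsNoetherianRing R] (hJ : J.FG) :
    Function.Bijective (toLimit N hJ) := by
  constructor
  · have := AdicCompletion.isNoetherianRing (J := J)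
    have := isAdicComplete_self J hJ
    have : IsHausdorff J N := IsHausdorff.map_algebraMap_iff.mp
      (IsHausdorff.of_le_jacobson (J.map (algebraMap R (AdicCompletion J R))) N
        (IsAdicComplete.le_jacobson_bot _))
    rw [injective_iff_map_eq_zero]
    intro y hy
    refine IsHausdorff.haus this y fun n ↦ SModEq.zero.mpr ?_
    exact (Submodule.Quotient.mk_eq_zero _).mp (congrFun (congrArg Subtype.val hy) n)
  · obtain ⟨t, d, hd⟩ := Module.Finite.exists_fin (R := AdicCompletion J R) (M := N)
    have h : Submodule.span (AdicCompletion J R) (Set.range fun i ↦ toLimit N hJ (d i)) = ⊤ :=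
      span_eq_top_of_span_eval_one_eq_top (span_range_mkQ_eq_top N hJ hd 1)
    rw [← LinearMap.range_eq_top, eq_top_iff, ← h, Submodule.span_le]
    rintro _ ⟨i, rfl⟩
    exact ⟨d i, rfl⟩

end OfModule

/-! ### Morphisms between objects of the completion -/

namespace AdicPresentation

variable {M N L : ProCat R (FGModuleCat.{u} R)} (X : AdicPresentation J M)
  (Y : AdicPresentation J N) (Z : AdicPresentation J L)

/-- The maps `M / MJⁿ ⟶ N / NJⁿ` exist by the universal property, as `J ^ n` annihilates the
target. -/
theorem exists_homMap (g : M ⟶ N) : ∃ h : X.diag ⟶ Y.diag,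
    ∀ n, X.proj n ≫ (ProCat.const R _).map (h.app (op n)) = g ≫ Y.proj n := by
  choose h hh using fun n ↦ X.exists_map (g ≫ Y.proj n) fun a ha ↦ Y.smul_id_eq_zero ha
  refine ⟨{ app n := h n.unop, naturality n m i := ?_ }, hh⟩
  refine X.hom_ext (n := n.unop) ?_
  have hX := X.proj_map (leOfHom i.unop)
  have hY := Y.proj_map (leOfHom i.unop)
  rw [Functor.map_comp, Functor.map_comp, reassoc_of% (hh n.unop)]
  exact ((Category.assoc _ _ _).symm.trans congr($hX ≫ _)).trans
    ((hh m.unop).trans congr(g ≫ $hY).symm)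

/-- The morphism of inverse systems `M / MJⁿ ⟶ N / NJⁿ` induced by a morphism `M ⟶ N`. -/
def homMap (g : M ⟶ N) : X.diag ⟶ Y.diag :=
  (X.exists_homMap Y g).choose

theorem proj_homMap (g : M ⟶ N) (n : ℕ) :
    X.proj n ≫ (ProCat.const R _).map ((X.homMap Y g).app (op n)) = g ≫ Y.proj n :=
  (X.exists_homMap Y g).choose_spec n

variable {X Y} in
theorem homMap_eq {g : M ⟶ N} {h : X.diag ⟶ Y.diag}
    (hh : ∀ n, X.proj n ≫ (ProCat.const R _).map (h.app (op n)) = g ≫ Y.proj n) :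
    X.homMap Y g = h := by
  refine NatTrans.ext (funext fun n ↦ X.hom_ext ?_)
  exact (X.proj_homMap Y g n.unop).trans (hh n.unop).symm

theorem homMap_id : X.homMap X (𝟙 M) = 𝟙 X.diag :=
  homMap_eq fun n ↦ by
    rw [Category.id_comp, NatTrans.id_app, CategoryTheory.Functor.map_id, Category.comp_id]

theorem homMap_comp (f : M ⟶ N) (g : N ⟶ L) :
    X.homMap Z (f ≫ g) = X.homMap Y f ≫ Y.homMap Z g :=
  homMap_eq fun n ↦ by
    rw [NatTrans.comp_app, Functor.map_comp, reassoc_of% (X.proj_homMap Y f n),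
      Y.proj_homMap Z g n, Category.assoc]

theorem homMap_add (f g : M ⟶ N) : X.homMap Y (f + g) = X.homMap Y f + X.homMap Y g :=
  homMap_eq fun n ↦ by
    rw [NatTrans.app_add, Functor.map_add, Preadditive.comp_add, proj_homMap, proj_homMap,
      Preadditive.add_comp]

theorem homMap_smul (a : R) (f : M ⟶ N) : X.homMap Y (a • f) = a • X.homMap Y f :=
  homMap_eq fun n ↦ by
    rw [NatTrans.app_smul, Functor.map_smul, Linear.comp_smul, proj_homMap, Linear.smul_comp]

/-- Morphisms of the completion are the same as morphisms between the adic systems of quotients. -/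
theorem homMap_bijective : Function.Bijective (X.homMap Y) := by
  constructor
  · intro f g h
    refine Y.isLimit.hom_ext fun n ↦ ?_
    exact (X.proj_homMap Y f n.unop).symm.trans ((h ▸ rfl : _ = _).trans
      (X.proj_homMap Y g n.unop))
  · intro h
    let c : Cone (Y.diag ⋙ ProCat.const R _) :=
      { pt := M, π := X.π ≫ Functor.whiskerRight h (ProCat.const R _) }
    exact ⟨Y.isLimit.lift c, homMap_eq fun n ↦ (Y.isLimit.fac c (op n)).symm⟩

/-- The limits of two presentations of the same pro-object are isomorphic. -/
def limitEquiv (X X' : AdicPresentation J M) :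
    X.adicSystem.limit ≃ₗ[AdicCompletion J R] X'.adicSystem.limit :=
  .ofLinearMap (AdicSystem.limitMap (X.homMap X' (𝟙 M)))
    (AdicSystem.limitMap (X'.homMap X (𝟙 M)))
    (by
      have h := (X'.homMap_comp X X' (𝟙 M) (𝟙 M)).symm
      rw [Category.comp_id, homMap_id] at h
      refine LinearMap.ext fun x ↦ AdicSystem.limit_ext fun n ↦ ?_
      exact congr((($h).app (op n)).hom.hom (x.1 n)))
    (by
      have h := (X.homMap_comp X' X (𝟙 M) (𝟙 M)).symm
      rw [Category.comp_id, homMap_id] at h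
      refine LinearMap.ext fun x ↦ AdicSystem.limit_ext fun n ↦ ?_
      exact congr((($h).app (op n)).hom.hom (x.1 n)))

end AdicPresentation

/-! ### Morphisms from the pro-object `lim_n R / J ^ n` -/

variable (J) in
/-- The adic system `(R / J ^ n)`. -/
def AdicSystem.unit : AdicSystem J where
  diag := (Monotone.functor (f := (ULift.up : ℕ → ULift.{u} ℕ)) fun _ _ h ↦ h).op ⋙
    _root_.adicSystem J
  surjective h := Ideal.Quotient.factor_surjective (Ideal.pow_le_pow_right h)
  ker_eq {m n} h := by
    have hq (y : R) : Ideal.Quotient.mk (J ^ n) y ∈ (J ^ m • ⊤ : Submodule R (R ⧸ J ^ n)) ↔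
        Ideal.Quotient.mk (J ^ m) y = 0 := by
      have hy : Ideal.Quotient.mk (J ^ n) y = Submodule.mkQ (J ^ n) y := rfl
      rw [hy, ← Submodule.range_mkQ (J ^ n), LinearMap.range_eq_map, ← Submodule.map_smul'',
        ← Submodule.mem_comap, Submodule.comap_map_mkQ, smul_eq_mul, Ideal.mul_top,
        sup_eq_right.mpr (Ideal.pow_le_pow_right h), Ideal.Quotient.eq_zero_iff_mem]
    ext x
    obtain ⟨y, rfl⟩ := Ideal.Quotient.mk_surjective (I := J ^ n) x
    exact (hq y).symm

variable (J) in
/-- The presentation of the pro-object `lim_n R / J ^ n` by its quotients `R / J ^ n`. -/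
def adicProPresentation : AdicPresentation J (adicPro J) :=
  (AdicSystem.unit J).presentation

namespace AdicSystem

variable (S : AdicSystem J)

/-- The compatible family of the images of `1`. -/
def elemOfHom (φ : (unit J).diag ⟶ S.diag) : S.limit :=
  ⟨fun n ↦ (φ.app (op n)).hom.hom (1 : R ⧸ J ^ n), fun _ n h ↦
    congr(($((φ.naturality (homOfLE h).op).symm)).hom.hom (1 : R ⧸ J ^ n))⟩

/-- A morphism of adic systems `(R / J ^ n) ⟶ (D n)` is determined by the images of `1`, which can
be any compatible family. -/
theorem elemOfHom_bijective : Function.Bijective S.elemOfHom := by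
  constructor
  · intro φ ψ h
    refine NatTrans.ext (funext fun n ↦ FGModuleCat.hom_ext (LinearMap.ext fun x ↦ ?_))
    obtain ⟨x, rfl⟩ := Ideal.Quotient.mk_surjective (I := J ^ n.unop) x
    have hx : Ideal.Quotient.mk (J ^ n.unop) x = x • (1 : R ⧸ J ^ n.unop) := by
      rw [Algebra.smul_def, mul_one]
      rfl
    have h1 : (φ.app n).hom.hom (1 : R ⧸ J ^ n.unop) = (ψ.app n).hom.hom (1 : R ⧸ J ^ n.unop) :=
      congrFun (congrArg Subtype.val h) n.unop
    refine (congrArg (φ.app n).hom.hom hx).trans (Eq.trans ?_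
      (congrArg (ψ.app n).hom.hom hx).symm)
    exact (map_smul _ _ _).trans ((congrArg (x • ·) h1).trans (map_smul _ _ _).symm)
  · intro x
    let f (n : ℕ) : R ⧸ J ^ n →ₗ[R] S.diag.obj (op n) :=
      (J ^ n).liftQ (LinearMap.toSpanSingleton R _ (x.1 n)) fun a ha ↦ S.smul_eq_zero ha _
    refine ⟨{ app n := FGModuleCat.ofHom (f n.unop), naturality n m i := ?_ }, ?_⟩
    · refine FGModuleCat.hom_ext (LinearMap.ext fun y ↦ ?_)
      obtain ⟨y, rfl⟩ := Ideal.Quotient.mk_surjective (I := J ^ n.unop) y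
      change y • x.1 m.unop = transition S.diag (leOfHom i.unop) (y • x.1 n.unop)
      rw [map_smul, transition_apply]
    · exact limit_ext fun n ↦ one_smul R (x.1 n)

end AdicSystem

namespace AdicPresentation

variable {M N : ProCat R (FGModuleCat.{u} R)} (X : AdicPresentation J M)
  (Y : AdicPresentation J N)

/-- Morphisms from `lim_n R / J ^ n` to `M` are the elements of `lim_n M / MJⁿ`. -/
def elemEquiv : (adicPro J ⟶ M) ≃+ X.adicSystem.limit :=
  AddEquiv.ofBijective
    (AddMonoidHom.mk' (fun f ↦ X.adicSystem.elemOfHom ((adicProPresentation J).homMap X f))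
      fun f g ↦ by
        rw [homMap_add]
        rfl)
    (X.adicSystem.elemOfHom_bijective.comp ((adicProPresentation J).homMap_bijective X))

theorem elemEquiv_smul (a : R) (f : adicPro J ⟶ M) :
    X.elemEquiv (a • f) = a • X.elemEquiv f := by
  change X.adicSystem.elemOfHom _ = a • X.adicSystem.elemOfHom _
  rw [homMap_smul]
  rfl

theorem elemEquiv_comp (f : adicPro J ⟶ M) (g : M ⟶ N) :
    Y.elemEquiv (f ≫ g) =
      AdicSystem.limitMap (S := X.adicSystem) (T := Y.adicSystem) (X.homMap Y g)
        (X.elemEquiv f) := by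
  change Y.adicSystem.elemOfHom _ = AdicSystem.limitMap _ (X.adicSystem.elemOfHom _)
  rw [homMap_comp _ X Y]
  rfl

end AdicPresentation

/-! ### The endomorphism ring of `lim_n R / J ^ n` -/

namespace AdicCompletionCat

/-- The object `lim_n R / J ^ n` of the completion of `mod(R)`. -/
abbrev proUnit (hP : IsAdicPro J (FGModuleCat.{u} R) (adicPro J)) :
    AdicCompletionCat J (FGModuleCat.{u} R) :=
  ⟨adicPro J, hP⟩

/-- A choice of presentation of an object of the completion of `mod(R)`. -/
def presentation (M : AdicCompletionCat J (FGModuleCat.{u} R)) : AdicPresentation J M.obj where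
  diag := M.property.choose
  π := M.property.choose_spec.choose
  isQuotient := M.property.choose_spec.choose_spec.1
  isLimit := M.property.choose_spec.choose_spec.2.some

variable {hP : IsAdicPro J (FGModuleCat.{u} R) (adicPro J)}

/-- The module `Hom(P, M)` for `P = lim_n R / J ^ n`, as the limit of `M / MJⁿ`. -/
def homEquiv {M : AdicCompletionCat J (FGModuleCat.{u} R)} (X : AdicPresentation J M.obj) :
    (proUnit hP ⟶ M) ≃+ X.adicSystem.limit where
  toFun f := X.elemEquiv f.hom
  invFun x := ObjectProperty.homMk (X.elemEquiv.symm x)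
  left_inv f := by
    ext1
    exact X.elemEquiv.symm_apply_apply f.hom
  right_inv x := X.elemEquiv.apply_symm_apply x
  map_add' f g := X.elemEquiv.map_add f.hom g.hom

theorem homEquiv_smul {M : AdicCompletionCat J (FGModuleCat.{u} R)} (X : AdicPresentation J M.obj)
    (a : R) (f : proUnit hP ⟶ M) : homEquiv X (a • f) = a • homEquiv X f :=
  X.elemEquiv_smul a f.hom

theorem homEquiv_comp {M N : AdicCompletionCat J (FGModuleCat.{u} R)}
    (X : AdicPresentation J M.obj) (Y : AdicPresentation J N.obj) (f : proUnit hP ⟶ M)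
    (g : M ⟶ N) :
    homEquiv Y (f ≫ g) =
      AdicSystem.limitMap (S := X.adicSystem) (T := Y.adicSystem) (X.homMap Y g.hom)
        (homEquiv X f) :=
  X.elemEquiv_comp Y f.hom g.hom

variable (hP) in
/-- The presentation of `lim_n R / J ^ n` by the modules `R / J ^ n`. -/
abbrev unitPresentation : AdicPresentation J (proUnit hP).obj := adicProPresentation J

variable (hP) in
/-- The compatible family of the units of the rings `R / J ^ n`. -/
def one : (unitPresentation hP).adicSystem.limit :=
  homEquiv (unitPresentation hP) (𝟙 (proUnit hP))

theorem one_apply (n : ℕ) : (one hP).1 n = (1 : R ⧸ J ^ n) := by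
  change (((adicProPresentation J).homMap (adicProPresentation J) (𝟙 (adicPro J))).app
    (op n)).hom.hom (1 : R ⧸ J ^ n) = _
  rw [AdicPresentation.homMap_id]
  rfl

theorem smul_one_apply (r : AdicCompletion J R) (n : ℕ) : (r • one hP).1 n = evalₐ J n r := by
  rw [AdicSystem.smul_apply (r.evalₐ_eq_mk_rep n), one_apply, r.evalₐ_eq_mk_rep]
  change r.rep n • (1 : R ⧸ J ^ n) = _
  rw [Algebra.smul_def, mul_one]
  rfl

/-- The unit freely generates `lim_n R / J ^ n` over the completed ring; it generates because it
generates `R / J`. -/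
theorem smul_one_bijective :
    Function.Bijective (fun r : AdicCompletion J R ↦ r • one hP) := by
  constructor
  · intro r s h
    refine ext_evalₐ fun n ↦ ?_
    rw [← smul_one_apply (hP := hP), ← smul_one_apply (hP := hP)]
    exact congrFun (congrArg Subtype.val h) n
  · intro x
    have hd : Submodule.span R (Set.range fun _ : Unit ↦ (one hP).1 1) = ⊤ := by
      refine eq_top_iff.mpr fun y _ ↦ ?_
      obtain ⟨y, rfl⟩ := Ideal.Quotient.mk_surjective (I := J ^ 1) y
      have hy : Ideal.Quotient.mk (J ^ 1) y = y • (one hP).1 1 := by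
        rw [one_apply]
        change _ = y • (1 : R ⧸ J ^ 1)
        rw [Algebra.smul_def, mul_one]
        rfl
      exact hy ▸ Submodule.smul_mem _ y (Submodule.subset_span (Set.mem_range_self ()))
    obtain ⟨c, -, hc⟩ := AdicSystem.exists_eq_sum hd (AdicSystem.apply_zero_eq x)
    exact ⟨c (), by simpa using hc.symm⟩

/-- The endomorphism of `lim_n R / J ^ n` given by multiplication by an element of the completed
ring. -/
def toEnd (r : AdicCompletion J R) : End (proUnit hP) :=
  (homEquiv (unitPresentation hP)).symm (r • one hP)

theorem homEquiv_toEnd (r : AdicCompletion J R) :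
    homEquiv (unitPresentation hP) (toEnd r) = r • one hP :=
  (homEquiv (unitPresentation hP)).apply_symm_apply _

/-- Under `Hom(P, M) = lim_n M / MJⁿ`, precomposition with endomorphisms of `P` is the action of the
completed ring. -/
theorem homEquiv_toEnd_comp {M : AdicCompletionCat J (FGModuleCat.{u} R)}
    (X : AdicPresentation J M.obj) (r : AdicCompletion J R) (f : proUnit hP ⟶ M) :
    homEquiv X (toEnd r ≫ f) = r • homEquiv X f := by
  rw [homEquiv_comp (unitPresentation hP) X, homEquiv_toEnd, map_smul, one,
    ← homEquiv_comp (unitPresentation hP) X, Category.id_comp]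

variable (hP) in
/-- The endomorphism ring of `lim_n R / J ^ n` is the completed ring. -/
def endEquiv : AdicCompletion J R ≃ₐ[R] End (proUnit hP) :=
  AlgEquiv.ofBijective
    { toFun := toEnd
      map_one' := (homEquiv (unitPresentation hP)).injective (by
        rw [homEquiv_toEnd, one_smul]
        rfl)
      map_mul' := fun r s ↦ (homEquiv (unitPresentation hP)).injective (by
        rw [End.mul_def, homEquiv_toEnd_comp, homEquiv_toEnd, homEquiv_toEnd, smul_smul, mul_comm])
      map_zero' := (homEquiv (unitPresentation hP)).injective (by
        rw [homEquiv_toEnd, zero_smul, _root_.map_zero])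
      map_add' := fun r s ↦ (homEquiv (unitPresentation hP)).injective (by
        rw [homEquiv_toEnd, map_add, homEquiv_toEnd, homEquiv_toEnd, add_smul])
      commutes' := fun a ↦ (homEquiv (unitPresentation hP)).injective (by
        rw [homEquiv_toEnd, AdicSystem.algebraMap_smul_eq]
        exact (homEquiv_smul _ a (𝟙 _)).symm) }
    ((homEquiv (unitPresentation hP)).symm.bijective.comp smul_one_bijective)

/-! ### The equivalence with finitely generated modules over the completed ring -/

variable (J) in
/-- The functor `M ↦ Hom(P, M) = lim_n M / MJⁿ` to finitely generated modules over the completed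
ring. -/
def limitFunctor :
    AdicCompletionCat J (FGModuleCat.{u} R) ⥤ FGModuleCat.{u} (AdicCompletion J R) where
  obj M := FGModuleCat.of _ M.presentation.adicSystem.limit
  map {M N} f := FGModuleCat.ofHom (AdicSystem.limitMap (S := M.presentation.adicSystem)
    (T := N.presentation.adicSystem) (M.presentation.homMap N.presentation f.hom))
  map_id M := by
    refine FGModuleCat.hom_ext (LinearMap.ext fun x ↦ AdicSystem.limit_ext fun n ↦ ?_)
    exact congr(((($(M.presentation.homMap_id)).app (op n)).hom.hom (x.1 n)))
  map_comp {M N L} f g := by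
    refine FGModuleCat.hom_ext (LinearMap.ext fun x ↦ AdicSystem.limit_ext fun n ↦ ?_)
    exact congr(((($(M.presentation.homMap_comp N.presentation L.presentation f.hom g.hom)).app
      (op n)).hom.hom (x.1 n)))

instance : (limitFunctor J).Additive where
  map_add {M N f g} := by
    refine FGModuleCat.hom_ext (LinearMap.ext fun x ↦ AdicSystem.limit_ext fun n ↦ ?_)
    exact congr(((($(M.presentation.homMap_add N.presentation f.hom g.hom)).app
      (op n)).hom.hom (x.1 n)))

theorem limitFunctor_map_smul {M N : AdicCompletionCat J (FGModuleCat.{u} R)} (a : R) (g : M ⟶ N)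
    (x : (limitFunctor J).obj M) : ((limitFunctor J).map (a • g)).hom.hom x =
      algebraMap R (AdicCompletion J R) a • ((limitFunctor J).map g).hom.hom x := by
  refine Eq.trans ?_ (AdicSystem.algebraMap_smul_eq (S := N.presentation.adicSystem) a _).symm
  refine AdicSystem.limit_ext fun n ↦ ?_
  exact congr(((($(M.presentation.homMap_smul N.presentation a g.hom)).app
      (op n)).hom.hom (x.1 n)))

instance : (limitFunctor J).Faithful where
  map_injective {M N f g} h := by
    ext1
    refine (M.presentation.homMap_bijective N.presentation).1 (AdicSystem.limitMap_injective
      (S := M.presentation.adicSystem) (T := N.presentation.adicSystem) ?_)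
    exact congr(($h).hom.hom)

instance [IsNoetherianRing R] : (limitFunctor J).Full where
  map_surjective {M N} f := by
    obtain ⟨φ, hφ⟩ := AdicSystem.limitMap_surjective (S := M.presentation.adicSystem)
      (T := N.presentation.adicSystem) (IsNoetherian.noetherian J) f.hom.hom
    obtain ⟨g, rfl⟩ := (M.presentation.homMap_bijective N.presentation).2 φ
    exact ⟨ObjectProperty.homMk g, FGModuleCat.hom_ext hφ⟩

/-- A finitely generated module `N` over the completed ring comes from the formal inverse limit of
the modules `N / J ^ n N`. -/
instance [IsNoetherianRing R] : (limitFunctor J).EssSurj where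
  mem_essImage N := by
    have hJ : J.FG := IsNoetherian.noetherian J
    let : Module R N := Module.compHom N (algebraMap R (AdicCompletion J R))
    have : IsScalarTower R (AdicCompletion J R) N := .of_algebraMap_smul fun _ _ ↦ rfl
    let S : AdicSystem J := .ofModule N hJ
    let M : AdicCompletionCat J (FGModuleCat.{u} R) := ⟨S.pro, S.isAdicPro⟩
    let e : M.presentation.adicSystem.limit ≃ₗ[AdicCompletion J R] N :=
      (M.presentation.limitEquiv S.presentation).trans
        (LinearEquiv.ofBijective _ (AdicSystem.toLimit_bijective N hJ)).symm
    exact ⟨M, ⟨e.toFGModuleCatIso⟩⟩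

instance [IsNoetherianRing R] : (limitFunctor J).IsEquivalence where

/-! ### The projective generator -/

theorem homEquiv_comp_presentation {M N : AdicCompletionCat J (FGModuleCat.{u} R)}
    (f : proUnit hP ⟶ M) (g : M ⟶ N) : homEquiv N.presentation (f ≫ g) =
      ((limitFunctor J).map g).hom.hom (homEquiv M.presentation f) :=
  homEquiv_comp _ _ f g

variable (hP) in
theorem isSeparator_proUnit : IsSeparator (proUnit hP) := by
  refine isSeparator_def _ |>.mpr fun M N f g h ↦ (limitFunctor J).map_injective ?_
  refine FGModuleCat.hom_ext (LinearMap.ext fun x ↦ ?_)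
  obtain ⟨k, rfl⟩ := (homEquiv (hP := hP) M.presentation).surjective x
  rw [← homEquiv_comp_presentation, ← homEquiv_comp_presentation, h]

variable [IsNoetherianRing R]

/-- Equivalences preserve epimorphisms, and epimorphisms of finitely generated modules are
surjective. -/
theorem surjective_limitFunctor_map {M N : AdicCompletionCat J (FGModuleCat.{u} R)} (g : M ⟶ N)
    [Epi g] : Function.Surjective ((limitFunctor J).map g).hom.hom :=
  (ModuleCat.epi_iff_surjective _).mp (inferInstanceAs
    (Epi ((forget₂ (FGModuleCat.{u} (AdicCompletion J R)) (ModuleCat _)).map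
      ((limitFunctor J).map g))))

variable (hP) in
theorem projective_proUnit : Projective (proUnit hP) where
  factors {M N} f g _ := by
    obtain ⟨x, hx⟩ := surjective_limitFunctor_map g (homEquiv N.presentation f)
    obtain ⟨k, rfl⟩ := (homEquiv (hP := hP) M.presentation).surjective x
    refine ⟨k, (homEquiv N.presentation).injective ?_⟩
    rw [homEquiv_comp_presentation, hx]

variable (hP) in
/-- Generators of the module `Hom(P, M)` define an epimorphism from a finite direct sum of copies
of `P` onto `M`. -/
theorem exists_epi_of_coproduct (M : AdicCompletionCat J (FGModuleCat.{u} R)) :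
    ∃ (t : ℕ) (c : Cofan (fun _ : Fin t ↦ proUnit hP)) (_ : IsColimit c) (f : c.pt ⟶ M),
      Epi f := by
  obtain ⟨t, d, hd⟩ := Module.Finite.exists_fin (R := AdicCompletion J R)
    (M := (limitFunctor J).obj M)
  have : HasColimitsOfShape (Discrete (Fin t)) (AdicCompletionCat J (FGModuleCat.{u} R)) :=
    Adjunction.hasColimitsOfShape_of_equivalence (limitFunctor J)
  let F : Fin t → AdicCompletionCat J (FGModuleCat.{u} R) := fun _ ↦ proUnit hP
  let p (i : Fin t) : proUnit hP ⟶ M := (homEquiv M.presentation).symm (d i)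
  refine ⟨t, colimit.cocone (Discrete.functor F), colimit.isColimit _, Sigma.desc (f := F) p,
    ⟨fun {N} g h hgh ↦ (limitFunctor J).map_injective (FGModuleCat.hom_ext ?_)⟩⟩
  refine LinearMap.ext_on_range hd fun i ↦ ?_
  have hi : homEquiv M.presentation (p i) = d i := AddEquiv.apply_symm_apply _ _
  rw [← hi, ← homEquiv_comp_presentation, ← homEquiv_comp_presentation,
    ← Sigma.ι_desc (f := F) p i, Category.assoc, Category.assoc]
  exact congr(homEquiv _ (Sigma.ι F i ≫ $hgh))

end AdicCompletionCat

open AdicCompletionCat in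
theorem proposition2p2p7 {R : Type u} [CommRing R] [IsNoetherianRing R] (J : Ideal R) :
    ∃ hP : IsAdicPro J (FGModuleCat.{u} R) (adicPro J),
      let P : AdicCompletionCat J (FGModuleCat.{u} R) := ⟨adicPro J, hP⟩
      -- `P` is a projective generator
      Projective P ∧ IsSeparator P ∧
      (∀ M : AdicCompletionCat J (FGModuleCat.{u} R),
        ∃ (t : ℕ) (c : Cofan (fun _ : Fin t ↦ P)) (_ : IsColimit c) (f : c.pt ⟶ M), Epi f) ∧
      -- the endomorphism ring of `P` is the completion of `R`, and `Hom(P, -)` defines an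
      -- equivalence `E` onto the finitely generated modules over it
      ∃ (e : AdicCompletion J R ≃ₐ[R] End P)
        (E : AdicCompletionCat J (FGModuleCat.{u} R) ≌ FGModuleCat.{u} (AdicCompletion J R)),
        E.functor.Additive ∧
        (∀ (M N : AdicCompletionCat J (FGModuleCat.{u} R)) (a : R) (g : M ⟶ N)
          (x : E.functor.obj M), (E.functor.map (a • g)).hom.hom x =
            algebraMap R (AdicCompletion J R) a • (E.functor.map g).hom.hom x) ∧
        ∃ φ : ∀ M : AdicCompletionCat J (FGModuleCat.{u} R), (P ⟶ M) ≃+ E.functor.obj M,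
          (∀ (M N : AdicCompletionCat J (FGModuleCat.{u} R)) (g : M ⟶ N) (f : P ⟶ M),
            φ N (f ≫ g) = (E.functor.map g).hom.hom (φ M f)) ∧
          ∀ (M : AdicCompletionCat J (FGModuleCat.{u} R)) (r : AdicCompletion J R) (f : P ⟶ M),
            φ M (e r ≫ f) = r • φ M f := by
  have hP : IsAdicPro J (FGModuleCat.{u} R) (adicPro J) := (AdicSystem.unit J).isAdicPro
  exact ⟨hP, projective_proUnit hP, isSeparator_proUnit hP, exists_epi_of_coproduct hP,
    endEquiv hP, (limitFunctor J).asEquivalence, inferInstanceAs (limitFunctor J).Additive,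
    fun M N a g x ↦ limitFunctor_map_smul a g x, fun M ↦ homEquiv M.presentation,
    fun M N g f ↦ homEquiv_comp_presentation f g, fun M r f ↦ homEquiv_toEnd_comp _ r f⟩
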